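/- Let $-\infty \le a \le b \le \infty$ and let $f : (a,b) \to \mathbb{R}$ be a locally integrable function whose $4$th distributional derivative is non-negative, that is, $\int_a^b f(x)\,\varphi^{(4)}(x)\,dx \ge 0$ for every non-negative test function $\varphi \in C_c^\infty((a,b))$. Let $A$ and $B$ be Hermitian $n \times n$ matrices, and let $J$ be the open set of all $t \in \mathbb{R}$ such that all eigenvalues of $A + tB$ lie in $(a,b)$. Then the function $$ t \mapsto \operatorname{tr} f(A + tB), \qquad t \in J, $$ where $f(A+tB)$ is defined by the functional calculus, is locally integrable on $J$ and its $4$th distributional derivative on $J$ is non-negative, that is, $\int_J \operatorname{tr} f(A+tB)\,\psi^{(4)}(t)\,dt \ge 0$ for every non-negative $\psi \in C_c^\infty(J)$. -/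

import Mathlib

open MeasureTheory
open scoped ContDiff

/-- The open interval `(a, b)` of real numbers; the end points may be infinite. -/
def realInterval (a b : EReal) : Set ℝ := {x : ℝ | a < (x : EReal) ∧ (x : EReal) < b}

/-- On the open set `U ⊆ ℝ`, the function `f` is locally integrable, hence defines a distribution,
and the `k`-th distributional derivative of `f` is non-negative, that is
`⟨f⁽ᵏ⁾, φ⟩ = (-1)ᵏ ∫_U f φ⁽ᵏ⁾ ≥ 0` for every non-negative test function `φ ∈ C_c^∞(U)`.
The values of `f` outside `U` play no role. -/
structure HasNonnegDistribDeriv (k : ℕ) (f : ℝ → ℝ) (U : Set ℝ) : Prop where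
  locallyIntegrableOn : LocallyIntegrableOn f U
  nonneg : ∀ φ : ℝ → ℝ, ContDiff ℝ ∞ φ → HasCompactSupport φ → tsupport φ ⊆ U →
    (∀ x, 0 ≤ φ x) → 0 ≤ (-1) ^ k * ∫ x in U, f x * iteratedDeriv k φ x

/-- The trace `tr f(M)` of a Hermitian matrix `M`, with `f(M)` given by the functional calculus;
`f(M)` is Hermitian, so that its trace is real. -/
noncomputable def traceFun {n : ℕ} (f : ℝ → ℝ) (M : Matrix (Fin n) (Fin n) ℂ) : ℝ :=
  (cfc f M).trace.re

/-- The set of those real `t` for which all eigenvalues of `A + t B` lie in `I`, so that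
`f(A + t B)` makes sense for a function `f` on `I`. It is open when `I` is an open interval
and `A` and `B` are Hermitian. -/
def pencilDomain {n : ℕ} (I : Set ℝ) (A B : Matrix (Fin n) (Fin n) ℂ) : Set ℝ :=
  {t : ℝ | spectrum ℝ (A + t • B) ⊆ I}

open Polynomial

/-! For a polynomial `p` with `q = p'`, cyclicity of the trace gives `(d/dt) tr p(A + tB) = tr (B
q(A + tB))`. Three more derivatives extract `3!` times the `u³` coefficient of `tr (B q(M + uB))`,
where `M = A + tB`. In an eigenbasis of `M` the fourth derivative is therefore `6 ∑ B_ij B_jk B_kl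
B_li q[λ_i, λ_j, λ_k, λ_l]`, with `q[...]` the third divided difference.

Taylor's formula with integral remainder writes `q[...]` as half the integral of `q'''(s)` against
the third divided difference of `(x - s)₊²`. Since `q''' = p⁗ ≥ 0`, it suffices to fix `s`. That
kernel is a sum of four cyclic rotations of one function, `cyclicPart`, and the weight of a 4-cycle
is invariant under rotation, so one rotation suffices. By `cyclicPart_eq` it is a sum of terms `r ·
v(y) v(w)`, where `r ≥ 0` and `v` depend on the opposite nodes `x, z`, or the same with the two
opposite pairs exchanged. As `B` is Hermitian, each term sums to `∑ r |∑_j v_j B_ij B_jk|² ≥ 0`.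
Coincidence of all four nodes is a point mass, treated separately by the same square. This gives
`iteratedDeriv_four_traceFun_eval_nonneg`.

For general `f`, mollify and then approximate by polynomials, keeping the fourth derivative
non-negative (`HasNonnegDistribDeriv.exists_polynomial_tendsto`). The polynomials converge almost
everywhere, and boundedly because non-negative fourth differences control the supremum by the `L¹`
norm.

Almost everywhere convergence at eigenvalues is delicate: an eigenvalue of `A + tB` that does not
depend on `t` may sit in the exceptional null set `Z`. For almost every `t`, however, only such
constant eigenvalues lie in `Z`, with constant multiplicities (`exists_ae_traceFun_const`), so the
traces converge up to additive constants. These are invisible to `ψ⁗`, whose integral is zero, and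
dominated convergence finishes the proof. -/

/-! ### Divided differences of polynomials, with confluent nodes allowed -/

/-- First divided difference of `x ↦ x ^ N`. -/
def powDD₁ : ℕ → ℝ → ℝ → ℝ
  | 0, _, _ => 0
  | N + 1, x, y => x * powDD₁ N x y + y ^ N

/-- Second divided difference of `x ↦ x ^ N`. -/
def powDD₂ : ℕ → ℝ → ℝ → ℝ → ℝ
  | 0, _, _, _ => 0
  | N + 1, x, y, z => x * powDD₂ N x y z + powDD₁ N y z

/-- Third divided difference of `x ↦ x ^ N`. -/
def powDD₃ : ℕ → ℝ → ℝ → ℝ → ℝ → ℝ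
  | 0, _, _, _, _ => 0
  | N + 1, x, y, z, w => x * powDD₃ N x y z w + powDD₂ N y z w

theorem powDD₁_sub (N : ℕ) (x y : ℝ) : (x - y) * powDD₁ N x y = x ^ N - y ^ N := by
  induction N with
  | zero => simp [powDD₁]
  | succ N ih => simp only [powDD₁]; linear_combination x * ih

/-- The recursion peels off the first node, so symmetry is not built in; the difference-quotient
identity supplies what is missing in each induction step. -/
theorem powDD₁_comm (N : ℕ) (x y : ℝ) : powDD₁ N x y = powDD₁ N y x := by
  induction N with
  | zero => simp [powDD₁]
  | succ N ih => simp only [powDD₁]; linear_combination powDD₁_sub N x y + y * ih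

theorem powDD₂_sub₁₂ (N : ℕ) (x y z : ℝ) :
    (x - y) * powDD₂ N x y z = powDD₁ N x z - powDD₁ N y z := by
  induction N with
  | zero => simp [powDD₁, powDD₂]
  | succ N ih => simp only [powDD₁, powDD₂]; linear_combination x * ih

theorem powDD₂_comm₁₂ (N : ℕ) (x y z : ℝ) : powDD₂ N x y z = powDD₂ N y x z := by
  induction N with
  | zero => simp [powDD₂]
  | succ N ih => simp only [powDD₂]; linear_combination powDD₂_sub₁₂ N x y z + y * ih

theorem powDD₂_rotate (N : ℕ) (x y z : ℝ) : powDD₂ N x y z = powDD₂ N y z x := by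
  induction N with
  | zero => simp [powDD₂]
  | succ N ih =>
    simp only [powDD₂]
    linear_combination powDD₂_sub₁₂ N x y z + y * ih + powDD₁_comm N x z

theorem powDD₂_sub₁₃ (N : ℕ) (x y z : ℝ) :
    (x - z) * powDD₂ N x y z = powDD₁ N x y - powDD₁ N z y := by
  have h1 : powDD₂ N x y z = powDD₂ N z x y := (powDD₂_rotate N z x y).symm
  rw [h1, powDD₂_comm₁₂]
  exact powDD₂_sub₁₂ N x z y

theorem powDD₃_sub₁₂ (N : ℕ) (x y z w : ℝ) :
    (x - y) * powDD₃ N x y z w = powDD₂ N x z w - powDD₂ N y z w := by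
  induction N with
  | zero => simp [powDD₂, powDD₃]
  | succ N ih => simp only [powDD₂, powDD₃]; linear_combination x * ih

theorem powDD₃_sub₁₃ (N : ℕ) (x y z w : ℝ) :
    (x - z) * powDD₃ N x y z w = powDD₂ N x y w - powDD₂ N z y w := by
  induction N with
  | zero => simp [powDD₂, powDD₃]
  | succ N ih =>
    simp only [powDD₂, powDD₃]
    linear_combination x * ih + (x - z) * powDD₂_comm₁₂ N y z w

theorem powDD₃_sub₁₄ (N : ℕ) (x y z w : ℝ) :
    (x - w) * powDD₃ N x y z w = powDD₂ N x y z - powDD₂ N w y z := by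
  induction N with
  | zero => simp [powDD₂, powDD₃]
  | succ N ih =>
    simp only [powDD₂, powDD₃]
    linear_combination x * ih - (x - w) * powDD₂_rotate N w y z

/-- First divided difference of a polynomial. -/
noncomputable def polyDD₁ (q : ℝ[X]) (x y : ℝ) : ℝ := q.sum fun N a => a * powDD₁ N x y

/-- Second divided difference of a polynomial. -/
noncomputable def polyDD₂ (q : ℝ[X]) (x y z : ℝ) : ℝ := q.sum fun N a => a * powDD₂ N x y z

/-- Third divided difference of a polynomial. -/
noncomputable def polyDD₃ (q : ℝ[X]) (x y z w : ℝ) : ℝ := q.sum fun N a => a * powDD₃ N x y z w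

theorem polyDD₁_sub (q : ℝ[X]) (x y : ℝ) :
    (x - y) * polyDD₁ q x y = q.eval x - q.eval y := by
  simp only [polyDD₁, eval_eq_sum, Polynomial.sum, Finset.mul_sum, ← Finset.sum_sub_distrib]
  exact Finset.sum_congr rfl fun N _ => by linear_combination q.coeff N * powDD₁_sub N x y

theorem polyDD₂_sub₁₂ (q : ℝ[X]) (x y z : ℝ) :
    (x - y) * polyDD₂ q x y z = polyDD₁ q x z - polyDD₁ q y z := by
  simp only [polyDD₁, polyDD₂, Polynomial.sum, Finset.mul_sum, ← Finset.sum_sub_distrib]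
  exact Finset.sum_congr rfl fun N _ => by linear_combination q.coeff N * powDD₂_sub₁₂ N x y z

theorem polyDD₂_sub₁₃ (q : ℝ[X]) (x y z : ℝ) :
    (x - z) * polyDD₂ q x y z = polyDD₁ q x y - polyDD₁ q z y := by
  simp only [polyDD₁, polyDD₂, Polynomial.sum, Finset.mul_sum, ← Finset.sum_sub_distrib]
  exact Finset.sum_congr rfl fun N _ => by linear_combination q.coeff N * powDD₂_sub₁₃ N x y z

theorem polyDD₃_sub₁₂ (q : ℝ[X]) (x y z w : ℝ) :
    (x - y) * polyDD₃ q x y z w = polyDD₂ q x z w - polyDD₂ q y z w := by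
  simp only [polyDD₃, polyDD₂, Polynomial.sum, Finset.mul_sum, ← Finset.sum_sub_distrib]
  exact Finset.sum_congr rfl fun N _ => by linear_combination q.coeff N * powDD₃_sub₁₂ N x y z w

theorem polyDD₃_sub₁₃ (q : ℝ[X]) (x y z w : ℝ) :
    (x - z) * polyDD₃ q x y z w = polyDD₂ q x y w - polyDD₂ q z y w := by
  simp only [polyDD₃, polyDD₂, Polynomial.sum, Finset.mul_sum, ← Finset.sum_sub_distrib]
  exact Finset.sum_congr rfl fun N _ => by linear_combination q.coeff N * powDD₃_sub₁₃ N x y z w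

theorem polyDD₃_sub₁₄ (q : ℝ[X]) (x y z w : ℝ) :
    (x - w) * polyDD₃ q x y z w = polyDD₂ q x y z - polyDD₂ q w y z := by
  simp only [polyDD₃, polyDD₂, Polynomial.sum, Finset.mul_sum, ← Finset.sum_sub_distrib]
  exact Finset.sum_congr rfl fun N _ => by linear_combination q.coeff N * powDD₃_sub₁₄ N x y z w

theorem powDD₁_self (N : ℕ) (x : ℝ) : powDD₁ N x x = (derivative (X ^ N : ℝ[X])).eval x := by
  induction N with
  | zero => simp [powDD₁]
  | succ N ih =>
    rw [pow_succ', derivative_mul]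
    simp [powDD₁, ih, add_comm]

theorem powDD₂_self (N : ℕ) (x : ℝ) :
    2 * powDD₂ N x x x = (derivative (derivative (X ^ N : ℝ[X]))).eval x := by
  induction N with
  | zero => simp [powDD₂]
  | succ N ih =>
    rw [pow_succ', derivative_mul, derivative_X, one_mul, derivative_add, derivative_mul,
      derivative_X, one_mul]
    simp only [powDD₂, powDD₁_self, eval_add, eval_mul, eval_X]
    linear_combination x * ih

theorem powDD₃_self (N : ℕ) (x : ℝ) :
    6 * powDD₃ N x x x x = (derivative (derivative (derivative (X ^ N : ℝ[X])))).eval x := by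
  induction N with
  | zero => simp [powDD₃]
  | succ N ih =>
    rw [pow_succ', derivative_mul, derivative_X, one_mul, derivative_add, derivative_mul,
      derivative_X, one_mul, derivative_add, derivative_add, derivative_mul, derivative_X, one_mul]
    simp only [powDD₃, eval_add, eval_mul, eval_X]
    linear_combination x * ih + 3 * powDD₂_self N x

/-- Transfers the confluent formulas from monomials to polynomials, with `φ` an iterated derivative.
-/
theorem eval_linearMap_eq_sum (φ : ℝ[X] →ₗ[ℝ] ℝ[X]) (q : ℝ[X]) (x : ℝ) :
    (φ q).eval x = q.sum fun N a => a * (φ (X ^ N)).eval x := by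
  conv_lhs => rw [q.as_sum_support_C_mul_X_pow]
  simp [Polynomial.sum, eval_finsetSum, ← smul_eq_C_mul]

theorem polyDD₁_self (q : ℝ[X]) (x : ℝ) : polyDD₁ q x x = (derivative q).eval x := by
  rw [eval_linearMap_eq_sum]
  simp only [polyDD₁, powDD₁_self]

theorem polyDD₂_self (q : ℝ[X]) (x : ℝ) :
    2 * polyDD₂ q x x x = (derivative (derivative q)).eval x := by
  have := eval_linearMap_eq_sum (derivative ∘ₗ derivative) q x
  simp only [LinearMap.comp_apply, ← powDD₂_self] at this
  rw [this]
  simp only [polyDD₂, Polynomial.sum, Finset.mul_sum]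
  exact Finset.sum_congr rfl fun _ _ => by ring

theorem polyDD₃_self (q : ℝ[X]) (x : ℝ) :
    6 * polyDD₃ q x x x x = (derivative (derivative (derivative q))).eval x := by
  have := eval_linearMap_eq_sum (derivative ∘ₗ derivative ∘ₗ derivative) q x
  simp only [LinearMap.comp_apply, ← powDD₃_self] at this
  rw [this]
  simp only [polyDD₃, Polynomial.sum, Finset.mul_sum]
  exact Finset.sum_congr rfl fun _ _ => by ring

/-! ### Divided differences of the truncated square `x ↦ (x - s)₊ ^ 2` -/

/-- The truncated square `(x - s)₊ ^ 2`. -/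
noncomputable def truncSq (s x : ℝ) : ℝ := if s < x then (x - s) ^ 2 else 0

/-- First divided difference of the truncated square. -/
noncomputable def splineKer₁ (s x y : ℝ) : ℝ :=
  if s < x then (if s < y then (x - s) + (y - s) else (x - s) ^ 2 / (x - y))
  else (if s < y then (y - s) ^ 2 / (y - x) else 0)

/-- Second divided difference of the truncated square. -/
noncomputable def splineKer₂ (s x y z : ℝ) : ℝ :=
  if s < x then
    if s < y then
      if s < z then 1 else 1 - (s - z) ^ 2 / ((x - z) * (y - z))
    else
      if s < z then 1 - (s - y) ^ 2 / ((x - y) * (z - y)) else (x - s) ^ 2 / ((x - y) * (x - z))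
  else
    if s < y then
      if s < z then 1 - (s - x) ^ 2 / ((y - x) * (z - x)) else (y - s) ^ 2 / ((y - x) * (y - z))
    else
      if s < z then (z - s) ^ 2 / ((z - x) * (z - y)) else 0

/-- The weight of the path `x, y, z` from a node `x` above `s` to a node `z` below `s`. -/
noncomputable def pathWeight (s x y z : ℝ) : ℝ :=
  if s < y then (s - z) / (y - z) else (x - s) / (x - y)

/-- The contribution to the third divided difference of the truncated square of the cyclic word
`x, y, z, w` read from `x`: summing it over the four rotations gives the divided difference. -/
noncomputable def cyclicPart (s x y z w : ℝ) : ℝ :=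
  if s < x then
    if s < z then
      if s < y ∨ s < w then 0
      else ((x - s) * (z - s) * ((s - y) + (s - w)) + (s - y) * (s - w) * ((x - s) + (z - s))) /
        (2 * ((x - y) * (x - w) * (z - y) * (z - w)))
    else pathWeight s x y z * pathWeight s x w z / (x - z)
  else 0

/-- Third divided difference of the truncated square. -/
noncomputable def splineKer₃ (s x y z w : ℝ) : ℝ :=
  cyclicPart s x y z w + cyclicPart s y z w x + cyclicPart s z w x y + cyclicPart s w x y z

theorem splineKer₁_sub (s x y : ℝ) :
    (x - y) * splineKer₁ s x y = truncSq s x - truncSq s y := by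
  unfold splineKer₁ truncSq
  split_ifs <;> grind

theorem splineKer₂_sub₁₂ (s x y z : ℝ) :
    (x - y) * splineKer₂ s x y z = splineKer₁ s x z - splineKer₁ s y z := by
  unfold splineKer₁ splineKer₂
  split_ifs <;> grind

theorem splineKer₂_sub₁₃ (s x y z : ℝ) :
    (x - z) * splineKer₂ s x y z = splineKer₁ s x y - splineKer₁ s z y := by
  unfold splineKer₁ splineKer₂
  split_ifs <;> grind

theorem splineKer₃_sub₁₂ (s x y z w : ℝ) :
    (x - y) * splineKer₃ s x y z w = splineKer₂ s x z w - splineKer₂ s y z w := by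
  -- Every denominator in the kernels joins a node above `s` to one not above `s`, so it never
  -- vanishes, even when nodes coincide; each sign pattern is then a rational identity.
  have key (u v : ℝ) (hu : s < u) (hv : ¬s < v) : u - v ≠ 0 := by grind
  unfold splineKer₃ splineKer₂ cyclicPart pathWeight
  by_cases hx : s < x <;> by_cases hy : s < y <;> by_cases hz : s < z <;> by_cases hw : s < w <;>
    simp only [hx, hy, hz, hw, if_true, if_false, or_self, or_true, or_false] <;>
    try have := key x y hx hy
  all_goals try have := key x z hx hz
  all_goals try have := key x w hx hw
  all_goals try have := key y x hy hx
  all_goals try have := key y z hy hz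
  all_goals try have := key y w hy hw
  all_goals try have := key z x hz hx
  all_goals try have := key z y hz hy
  all_goals try have := key z w hz hw
  all_goals try have := key w x hw hx
  all_goals try have := key w y hw hy
  all_goals try have := key w z hw hz
  all_goals first | ring1 | (field_simp; ring1)

theorem splineKer₃_sub₁₃ (s x y z w : ℝ) :
    (x - z) * splineKer₃ s x y z w = splineKer₂ s x y w - splineKer₂ s z y w := by
  have key (u v : ℝ) (hu : s < u) (hv : ¬s < v) : u - v ≠ 0 := by grind
  unfold splineKer₃ splineKer₂ cyclicPart pathWeight
  by_cases hx : s < x <;> by_cases hy : s < y <;> by_cases hz : s < z <;> by_cases hw : s < w <;>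
    simp only [hx, hy, hz, hw, if_true, if_false, or_self, or_true, or_false] <;>
    try have := key x y hx hy
  all_goals try have := key x z hx hz
  all_goals try have := key x w hx hw
  all_goals try have := key y x hy hx
  all_goals try have := key y z hy hz
  all_goals try have := key y w hy hw
  all_goals try have := key z x hz hx
  all_goals try have := key z y hz hy
  all_goals try have := key z w hz hw
  all_goals try have := key w x hw hx
  all_goals try have := key w y hw hy
  all_goals try have := key w z hw hz
  all_goals first | ring1 | (field_simp; ring1)

theorem splineKer₃_sub₁₄ (s x y z w : ℝ) :
    (x - w) * splineKer₃ s x y z w = splineKer₂ s x y z - splineKer₂ s w y z := by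
  have key (u v : ℝ) (hu : s < u) (hv : ¬s < v) : u - v ≠ 0 := by grind
  unfold splineKer₃ splineKer₂ cyclicPart pathWeight
  by_cases hx : s < x <;> by_cases hy : s < y <;> by_cases hz : s < z <;> by_cases hw : s < w <;>
    simp only [hx, hy, hz, hw, if_true, if_false, or_self, or_true, or_false] <;>
    try have := key x y hx hy
  all_goals try have := key x z hx hz
  all_goals try have := key x w hx hw
  all_goals try have := key y x hy hx
  all_goals try have := key y z hy hz
  all_goals try have := key y w hy hw
  all_goals try have := key z x hz hx
  all_goals try have := key z y hz hy
  all_goals try have := key z w hz hw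
  all_goals try have := key w x hw hx
  all_goals try have := key w y hw hy
  all_goals try have := key w z hw hz
  all_goals first | ring1 | (field_simp; ring1)

/-! ### Peano kernel representation of divided differences -/

theorem integral_ite_lt_of_hasDerivAt {Φ φ : ℝ → ℝ} (hΦ : ∀ s, HasDerivAt Φ (φ s) s)
    (hφ : Continuous φ) {c d x : ℝ} (hcx : c ≤ x) (hxd : x ≤ d) :
    IntervalIntegrable (fun s => if s < x then φ s else 0) volume c d ∧
      ∫ s in c..d, (if s < x then φ s else 0) = Φ x - Φ c := by
  have h1 : Set.EqOn φ (fun s => if s < x then φ s else 0) (Set.uIoo c x) := by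
    intro s hs
    rw [Set.uIoo_of_le hcx] at hs
    simp [hs.2]
  have h2 : Set.EqOn (fun _ => (0 : ℝ)) (fun s => if s < x then φ s else 0) (Set.uIoo x d) := by
    intro s hs
    rw [Set.uIoo_of_le hxd] at hs
    simp [hs.1.le]
  have i1 : IntervalIntegrable (fun s => if s < x then φ s else 0) volume c x :=
    (hφ.intervalIntegrable c x).congr_uIoo h1
  have i2 : IntervalIntegrable (fun s => if s < x then φ s else 0) volume x d :=
    intervalIntegrable_const.congr_uIoo h2
  refine ⟨i1.trans i2, ?_⟩
  rw [← intervalIntegral.integral_add_adjacent_intervals i1 i2,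
    ← intervalIntegral.integral_congr_uIoo h1, ← intervalIntegral.integral_congr_uIoo h2,
    intervalIntegral.integral_eq_sub_of_hasDerivAt (fun s _ => hΦ s) (hφ.intervalIntegrable c x)]
  simp

/-- Raises the order of the Peano formula by one: divide the difference-quotient identity by `x -
y`. Coincident nodes must therefore be handled through another pair of nodes, or directly. -/
theorem integral_mul_of_sub_mul_eq {w K K₁ K₂ : ℝ → ℝ} {c d x y v₁ v₂ : ℝ} (hxy : x ≠ y)
    (hK : ∀ s, (x - y) * K s = K₁ s - K₂ s)
    (h₁ : IntervalIntegrable (fun s => w s * K₁ s) volume c d ∧ ∫ s in c..d, w s * K₁ s = v₁)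
    (h₂ : IntervalIntegrable (fun s => w s * K₂ s) volume c d ∧ ∫ s in c..d, w s * K₂ s = v₂) :
    IntervalIntegrable (fun s => w s * K s) volume c d ∧
      (x - y) * ∫ s in c..d, w s * K s = v₁ - v₂ := by
  have hxy' : x - y ≠ 0 := sub_ne_zero.2 hxy
  have e : (fun s => w s * K s) = fun s => (x - y)⁻¹ * (w s * K₁ s - w s * K₂ s) := by
    funext s
    rw [← mul_sub, ← hK]
    field_simp
  rw [e]
  refine ⟨(h₁.1.sub h₂.1).const_mul _, ?_⟩
  rw [intervalIntegral.integral_const_mul, intervalIntegral.integral_sub h₁.1 h₂.1, h₁.2, h₂.2]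
  field_simp

section Peano

variable (q : ℝ[X]) {c d x y z w : ℝ}

theorem integral_mul_truncSq (hx : x ∈ Set.Icc c d) :
    IntervalIntegrable (fun s => (derivative (derivative (derivative q))).eval s * truncSq s x)
        volume c d ∧
      ∫ s in c..d, (derivative (derivative (derivative q))).eval s * truncSq s x =
        2 * (q.eval x - (q.eval c + (derivative q).eval c * (x - c) +
          (derivative (derivative q)).eval c / 2 * (x - c) ^ 2)) := by
  -- Antiderivative obtained by integrating by parts twice; its values at `c` and `x` give the
  -- second-order Taylor remainder at `c`.
  have hΦ (s : ℝ) : HasDerivAt (fun s => (derivative (derivative q)).eval s * (x - s) ^ 2 +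
      2 * (derivative q).eval s * (x - s) + 2 * q.eval s)
      ((derivative (derivative (derivative q))).eval s * (x - s) ^ 2) s := by
    have h0 := q.hasDerivAt s
    have h1 := (derivative q).hasDerivAt s
    have h2 := (derivative (derivative q)).hasDerivAt s
    have hl : HasDerivAt (fun s => x - s) (-1) s := (hasDerivAt_id s).const_sub x
    refine (((h2.fun_mul (hl.fun_pow 2)).fun_add ((h1.const_mul 2).fun_mul hl)).fun_add
      (h0.const_mul 2)).congr_deriv ?_
    norm_num
    ring
  have h := integral_ite_lt_of_hasDerivAt hΦ (by fun_prop) hx.1 hx.2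
  have e : (fun s => (derivative (derivative (derivative q))).eval s * truncSq s x) = fun s =>
      if s < x then (derivative (derivative (derivative q))).eval s * (x - s) ^ 2 else 0 := by
    funext s; simp [truncSq]
  rw [e]
  refine ⟨h.1, h.2.trans ?_⟩
  ring

theorem integral_mul_splineKer₁ (hx : x ∈ Set.Icc c d) (hy : y ∈ Set.Icc c d) :
    IntervalIntegrable (fun s => (derivative (derivative (derivative q))).eval s * splineKer₁ s x y)
        volume c d ∧
      ∫ s in c..d, (derivative (derivative (derivative q))).eval s * splineKer₁ s x y =
        2 * (polyDD₁ q x y - ((derivative q).eval c +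
          (derivative (derivative q)).eval c / 2 * (x + y - 2 * c))) := by
  rcases eq_or_ne x y with rfl | hxy
  · have hΦ (s : ℝ) : HasDerivAt (fun s => 2 * (derivative (derivative q)).eval s * (x - s) +
        2 * (derivative q).eval s)
        ((derivative (derivative (derivative q))).eval s * ((x - s) + (x - s))) s := by
      have h1 := (derivative q).hasDerivAt s
      have h2 := (derivative (derivative q)).hasDerivAt s
      have hl : HasDerivAt (fun s => x - s) (-1) s := (hasDerivAt_id s).const_sub x
      refine (((h2.const_mul 2).fun_mul hl).fun_add (h1.const_mul 2)).congr_deriv ?_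
      ring
    have h := integral_ite_lt_of_hasDerivAt hΦ (by fun_prop) hx.1 hx.2
    have e : (fun s => (derivative (derivative (derivative q))).eval s * splineKer₁ s x x) =
        fun s => if s < x then
          (derivative (derivative (derivative q))).eval s * ((x - s) + (x - s)) else 0 := by
      funext s
      by_cases hs : s < x <;> simp [splineKer₁, hs]
    rw [e]
    refine ⟨h.1, h.2.trans ?_⟩
    rw [polyDD₁_self]
    ring
  · have h := integral_mul_of_sub_mul_eq hxy (fun s => splineKer₁_sub s x y)
      (integral_mul_truncSq q hx) (integral_mul_truncSq q hy)
    refine ⟨h.1, mul_left_cancel₀ (sub_ne_zero.2 hxy) (h.2.trans ?_)⟩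
    linear_combination -2 * polyDD₁_sub q x y

theorem integral_mul_splineKer₂ (hx : x ∈ Set.Icc c d) (hy : y ∈ Set.Icc c d)
    (hz : z ∈ Set.Icc c d) :
    IntervalIntegrable
        (fun s => (derivative (derivative (derivative q))).eval s * splineKer₂ s x y z)
        volume c d ∧
      ∫ s in c..d, (derivative (derivative (derivative q))).eval s * splineKer₂ s x y z =
        2 * (polyDD₂ q x y z - (derivative (derivative q)).eval c / 2) := by
  rcases eq_or_ne x y with rfl | hxy
  · rcases eq_or_ne x z with rfl | hxz
    · have h := integral_ite_lt_of_hasDerivAt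
        (fun s => (derivative (derivative q)).hasDerivAt s) (by fun_prop) hx.1 hx.2
      have e : (fun s => (derivative (derivative (derivative q))).eval s * splineKer₂ s x x x) =
          fun s => if s < x then (derivative (derivative (derivative q))).eval s else 0 := by
        funext s
        by_cases hs : s < x <;> simp [splineKer₂, hs]
      rw [e]
      refine ⟨h.1, h.2.trans ?_⟩
      rw [← polyDD₂_self]
      ring
    · have h := integral_mul_of_sub_mul_eq hxz (fun s => splineKer₂_sub₁₃ s x x z)
        (integral_mul_splineKer₁ q hx hx) (integral_mul_splineKer₁ q hz hx)
      refine ⟨h.1, mul_left_cancel₀ (sub_ne_zero.2 hxz) (h.2.trans ?_)⟩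
      linear_combination -2 * polyDD₂_sub₁₃ q x x z
  · have h := integral_mul_of_sub_mul_eq hxy (fun s => splineKer₂_sub₁₂ s x y z)
      (integral_mul_splineKer₁ q hx hz) (integral_mul_splineKer₁ q hy hz)
    refine ⟨h.1, mul_left_cancel₀ (sub_ne_zero.2 hxy) (h.2.trans ?_)⟩
    linear_combination -2 * polyDD₂_sub₁₂ q x y z

/-- At this order the Taylor polynomial has dropped out. Four equal nodes are excluded: there the
kernel vanishes identically, while the divided difference is `q'''(x) / 6`. -/
theorem integral_mul_splineKer₃ (hx : x ∈ Set.Icc c d) (hy : y ∈ Set.Icc c d)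
    (hz : z ∈ Set.Icc c d) (hw : w ∈ Set.Icc c d) (hne : ¬(x = y ∧ x = z ∧ x = w)) :
    IntervalIntegrable
        (fun s => (derivative (derivative (derivative q))).eval s * splineKer₃ s x y z w)
        volume c d ∧
      ∫ s in c..d, (derivative (derivative (derivative q))).eval s * splineKer₃ s x y z w =
        2 * polyDD₃ q x y z w := by
  rcases eq_or_ne x y with rfl | hxy
  · rcases eq_or_ne x z with rfl | hxz
    · have hxw : x ≠ w := by tauto
      have h := integral_mul_of_sub_mul_eq hxw (fun s => splineKer₃_sub₁₄ s x x x w)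
        (integral_mul_splineKer₂ q hx hx hx) (integral_mul_splineKer₂ q hw hx hx)
      refine ⟨h.1, mul_left_cancel₀ (sub_ne_zero.2 hxw) (h.2.trans ?_)⟩
      linear_combination -2 * polyDD₃_sub₁₄ q x x x w
    · have h := integral_mul_of_sub_mul_eq hxz (fun s => splineKer₃_sub₁₃ s x x z w)
        (integral_mul_splineKer₂ q hx hx hw) (integral_mul_splineKer₂ q hz hx hw)
      refine ⟨h.1, mul_left_cancel₀ (sub_ne_zero.2 hxz) (h.2.trans ?_)⟩
      linear_combination -2 * polyDD₃_sub₁₃ q x x z w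
  · have h := integral_mul_of_sub_mul_eq hxy (fun s => splineKer₃_sub₁₂ s x y z w)
      (integral_mul_splineKer₂ q hx hz hw) (integral_mul_splineKer₂ q hy hz hw)
    refine ⟨h.1, mul_left_cancel₀ (sub_ne_zero.2 hxy) (h.2.trans ?_)⟩
    linear_combination -2 * polyDD₃_sub₁₂ q x y z w

end Peano

theorem splineKer₃_self (s x : ℝ) : splineKer₃ s x x x x = 0 := by
  by_cases hs : s < x <;> simp [splineKer₃, cyclicPart, hs]

/-! ### Positivity of the fourth-order trace form -/

section Positivity

variable {n : ℕ} {B : Matrix (Fin n) (Fin n) ℂ}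

/-- The real part of the product of the entries of `B` along the cycle `i, j, k, l`. -/
def cycleWeight (B : Matrix (Fin n) (Fin n) ℂ) (i j k l : Fin n) : ℝ :=
  (B i j * B j k * B k l * B l i).re

theorem cycleWeight_rotate (B : Matrix (Fin n) (Fin n) ℂ) (i j k l : Fin n) :
    cycleWeight B j k l i = cycleWeight B i j k l := by
  unfold cycleWeight; congr 1; ring

theorem sum_cyclic_rotate (g : Fin n → Fin n → Fin n → Fin n → ℝ) :
    ∑ i, ∑ j, ∑ k, ∑ l, g j k l i = ∑ i, ∑ j, ∑ k, ∑ l, g i j k l := by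
  rw [Finset.sum_comm]
  refine Finset.sum_congr rfl fun j _ => ?_
  rw [Finset.sum_comm]
  refine Finset.sum_congr rfl fun k _ => ?_
  rw [Finset.sum_comm]

/-- Renaming the summation indices cyclically turns each rotation of `cyclicPart` into the first,
since the weight does not change. -/
theorem sum_cycleWeight_mul_splineKer₃ (B : Matrix (Fin n) (Fin n) ℂ) (s : ℝ) (ev : Fin n → ℝ) :
    ∑ i, ∑ j, ∑ k, ∑ l, cycleWeight B i j k l * splineKer₃ s (ev i) (ev j) (ev k) (ev l) =
      4 * ∑ i, ∑ j, ∑ k, ∑ l,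
        cycleWeight B i j k l * cyclicPart s (ev i) (ev j) (ev k) (ev l) := by
  have r := sum_cyclic_rotate fun i j k l =>
    cycleWeight B i j k l * cyclicPart s (ev i) (ev j) (ev k) (ev l)
  have r2 := sum_cyclic_rotate fun i j k l =>
    cycleWeight B j k l i * cyclicPart s (ev j) (ev k) (ev l) (ev i)
  have r3 := sum_cyclic_rotate fun i j k l =>
    cycleWeight B k l i j * cyclicPart s (ev k) (ev l) (ev i) (ev j)
  simp only [cycleWeight_rotate] at r r2 r3
  simp only [splineKer₃, mul_add, Finset.sum_add_distrib]
  rw [r3, r2, r]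
  ring

/-- A weighted sum over cycles whose weight splits into two equal paths is a sum of squares. -/
theorem sum_cycleWeight_mul_path_nonneg (hB : B.IsHermitian) (i k : Fin n) (v : Fin n → ℝ) :
    0 ≤ ∑ j, ∑ l, cycleWeight B i j k l * (v j * v l) := by
  have e : ∑ j, ∑ l, cycleWeight B i j k l * (v j * v l) =
      Complex.normSq (∑ j, (v j : ℂ) * (B i j * B j k)) := by
    have h : ((∑ j, (v j : ℂ) * (B i j * B j k)) *
        (starRingEnd ℂ) (∑ l, (v l : ℂ) * (B i l * B l k))).re =
        Complex.normSq (∑ j, (v j : ℂ) * (B i j * B j k)) := by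
      rw [Complex.mul_conj, Complex.ofReal_re]
    rw [← h, map_sum, Finset.sum_mul_sum, Complex.re_sum]
    refine Finset.sum_congr rfl fun j _ => ?_
    rw [Complex.re_sum]
    refine Finset.sum_congr rfl fun l _ => ?_
    have h1 : (starRingEnd ℂ) (B i l) = B l i := hB.apply l i
    have h2 : (starRingEnd ℂ) (B l k) = B k l := hB.apply k l
    rw [map_mul, map_mul, h1, h2, Complex.conj_ofReal, cycleWeight, mul_comm,
      ← Complex.re_ofReal_mul]
    congr 1
    push_cast
    ring
  rw [e]
  exact Complex.normSq_nonneg _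

/-- Exhibits the sum of squares: in each summand the first factor is non-negative and depends on one
opposite pair of the cycle, and the rest is one function taken at both nodes of the other pair. The
outer pair is `x, z` in the first two summands and `y, w` in the third. -/
theorem cyclicPart_eq (s x y z w : ℝ) :
    cyclicPart s x y z w =
      (if s < x ∧ ¬s < z then 1 / (x - z) else 0) * (pathWeight s x y z * pathWeight s x w z) +
      (if s < x ∧ s < z then ((x - s) + (z - s)) / 2 else 0) *
        ((if s < y then 0 else (s - y) / ((x - y) * (z - y))) *
          (if s < w then 0 else (s - w) / ((x - w) * (z - w)))) +
      (if s < y ∨ s < w then 0 else ((s - y) + (s - w)) / 2) *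
        ((if s < z then (z - s) / ((z - y) * (z - w)) else 0) *
          (if s < x then (x - s) / ((x - y) * (x - w)) else 0)) := by
  have key (u v : ℝ) (hu : s < u) (hv : ¬s < v) : u - v ≠ 0 := by grind
  unfold cyclicPart
  by_cases hx : s < x <;> by_cases hz : s < z
  · by_cases hy : s < y
    · simp [hx, hz, hy]
    · by_cases hw : s < w
      · simp [hx, hz, hw]
      · have := key x y hx hy
        have := key x w hx hw
        have := key z y hz hy
        have := key z w hz hw
        simp only [hx, hy, hz, hw, or_self, if_true, if_false, and_self, not_true, and_false]
        field_simp
        ring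
  · simp only [hx, hz, if_true, if_false, not_false_iff, and_self, and_false]
    ring
  · simp [hx]
  · simp [hx]

theorem sum_cycleWeight_mul_cyclicPart_nonneg (hB : B.IsHermitian) (s : ℝ) (ev : Fin n → ℝ) :
    0 ≤ ∑ i, ∑ j, ∑ k, ∑ l,
      cycleWeight B i j k l * cyclicPart s (ev i) (ev j) (ev k) (ev l) := by
  have swap (g : Fin n → Fin n → Fin n → Fin n → ℝ) :
      ∑ i, ∑ j, ∑ k, ∑ l, g i j k l = ∑ i, ∑ k, ∑ j, ∑ l, g i j k l :=
    Finset.sum_congr rfl fun i _ => Finset.sum_comm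
  have factor (r : ℝ) (i k : Fin n) (v : Fin n → ℝ) (hr : 0 ≤ r) :
      0 ≤ ∑ j, ∑ l, cycleWeight B i j k l * (r * (v j * v l)) := by
    have := mul_nonneg hr (sum_cycleWeight_mul_path_nonneg hB i k v)
    simp only [Finset.mul_sum] at this
    refine this.trans_eq (Finset.sum_congr rfl fun j _ => Finset.sum_congr rfl fun l _ => ?_)
    ring
  simp only [cyclicPart_eq, mul_add, Finset.sum_add_distrib]
  refine add_nonneg (add_nonneg ?_ ?_) ?_
  · rw [swap]
    refine Finset.sum_nonneg fun i _ => Finset.sum_nonneg fun k _ =>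
      factor _ i k (fun j => pathWeight s (ev i) (ev j) (ev k)) ?_
    split_ifs with h
    · exact one_div_nonneg.2 (by linarith [h.1, not_lt.1 h.2])
    · exact le_rfl
  · rw [swap]
    refine Finset.sum_nonneg fun i _ => Finset.sum_nonneg fun k _ =>
      factor _ i k (fun j => if s < ev j then 0 else
        (s - ev j) / ((ev i - ev j) * (ev k - ev j))) ?_
    split_ifs with h
    · linarith [h.1, h.2]
    · exact le_rfl
  -- Here the pairs are exchanged; rotating the cycle by one step brings the third summand to the
  -- form of the other two.
  · rw [sum_cyclic_rotate fun i j k l => cycleWeight B l i j k *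
      ((if s < ev i ∨ s < ev k then 0 else ((s - ev i) + (s - ev k)) / 2) *
        ((if s < ev j then (ev j - s) / ((ev j - ev i) * (ev j - ev k)) else 0) *
          (if s < ev l then (ev l - s) / ((ev l - ev i) * (ev l - ev k)) else 0))), swap]
    refine Finset.sum_nonneg fun i _ => Finset.sum_nonneg fun k _ => ?_
    simp only [fun j l => (cycleWeight_rotate B l i j k).symm]
    refine factor _ i k (fun j => if s < ev j then
      (ev j - s) / ((ev j - ev i) * (ev j - ev k)) else 0) ?_
    split_ifs with h
    · exact le_rfl
    · simp only [not_or, not_lt] at h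
      linarith [h.1, h.2]

/-- If the third derivative of `q` is non-negative on an interval containing the numbers `ev i`,
then the quartic form in `B` with coefficients the third divided differences of `q` is
non-negative. -/
theorem sum_cycleWeight_mul_polyDD₃_nonneg (hB : B.IsHermitian) {c d : ℝ} (ev : Fin n → ℝ)
    (hev : ∀ i, ev i ∈ Set.Icc c d) (q : ℝ[X])
    (hq : ∀ x ∈ Set.Icc c d, 0 ≤ (derivative (derivative (derivative q))).eval x) :
    0 ≤ ∑ i, ∑ j, ∑ k, ∑ l, cycleWeight B i j k l * polyDD₃ q (ev i) (ev j) (ev k) (ev l) := by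
  rcases isEmpty_or_nonempty (Fin n) with hn | ⟨⟨i₀⟩⟩
  · simp
  have hcd : c ≤ d := (hev i₀).1.trans (hev i₀).2
  classical
  set r := derivative (derivative (derivative q)) with hr
  -- The Peano integral, plus a correction living only on fully coincident nodes, where the kernel
  -- misses the point mass.
  have split (i j k l : Fin n) : cycleWeight B i j k l * polyDD₃ q (ev i) (ev j) (ev k) (ev l) =
      (1 / 2) * (∫ s in c..d, r.eval s *
        (cycleWeight B i j k l * splineKer₃ s (ev i) (ev j) (ev k) (ev l))) +
      cycleWeight B i j k l * (if ev i = ev j ∧ ev i = ev k ∧ ev i = ev l then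
        r.eval (ev i) / 6 else 0) := by
    have e : ∀ s, r.eval s * (cycleWeight B i j k l * splineKer₃ s (ev i) (ev j) (ev k) (ev l)) =
        cycleWeight B i j k l * (r.eval s * splineKer₃ s (ev i) (ev j) (ev k) (ev l)) :=
      fun s => by ring
    simp only [e, intervalIntegral.integral_const_mul]
    split_ifs with h
    · obtain ⟨h1, h2, h3⟩ := h
      rw [← h1, ← h2, ← h3]
      simp only [splineKer₃_self, mul_zero, intervalIntegral.integral_zero]
      rw [hr, ← polyDD₃_self]
      ring
    · rw [(integral_mul_splineKer₃ q (hev i) (hev j) (hev k) (hev l) h).2]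
      ring
  have integrable (i j k l : Fin n) : IntervalIntegrable (fun s => r.eval s *
      (cycleWeight B i j k l * splineKer₃ s (ev i) (ev j) (ev k) (ev l))) volume c d := by
    have e : (fun s => r.eval s *
        (cycleWeight B i j k l * splineKer₃ s (ev i) (ev j) (ev k) (ev l))) =
        fun s => cycleWeight B i j k l * (r.eval s * splineKer₃ s (ev i) (ev j) (ev k) (ev l)) := by
      funext s; ring
    rw [e]
    refine IntervalIntegrable.const_mul ?_ _
    by_cases h : ev i = ev j ∧ ev i = ev k ∧ ev i = ev l
    · obtain ⟨h1, h2, h3⟩ := h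
      rw [← h1, ← h2, ← h3]
      simp [splineKer₃_self]
    · exact (integral_mul_splineKer₃ q (hev i) (hev j) (hev k) (hev l) h).1
  have sumI {F : Fin n → ℝ → ℝ} (h : ∀ j, IntervalIntegrable (F j) volume c d) :
      IntervalIntegrable (fun s => ∑ j, F j s) volume c d := by
    simpa only [Finset.sum_fn] using IntervalIntegrable.sum Finset.univ fun j _ => h j
  simp only [split, Finset.sum_add_distrib]
  refine add_nonneg ?_ ?_
  · simp only [← Finset.mul_sum]
    refine mul_nonneg (by norm_num) ?_
    have e : ∑ i, ∑ j, ∑ k, ∑ l, ∫ s in c..d, r.eval s *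
        (cycleWeight B i j k l * splineKer₃ s (ev i) (ev j) (ev k) (ev l)) =
        ∫ s in c..d, r.eval s * ∑ i, ∑ j, ∑ k, ∑ l,
          cycleWeight B i j k l * splineKer₃ s (ev i) (ev j) (ev k) (ev l) := by
      simp only [Finset.mul_sum]
      rw [intervalIntegral.integral_finsetSum fun i _ => by
        exact sumI fun j => sumI fun k => sumI fun l => integrable i j k l]
      refine Finset.sum_congr rfl fun i _ => ?_
      rw [intervalIntegral.integral_finsetSum fun j _ => by
        exact sumI fun k => sumI fun l => integrable i j k l]
      refine Finset.sum_congr rfl fun j _ => ?_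
      rw [intervalIntegral.integral_finsetSum fun k _ => by
        exact sumI fun l => integrable i j k l]
      refine Finset.sum_congr rfl fun k _ => ?_
      rw [intervalIntegral.integral_finsetSum fun l _ => integrable i j k l]
    rw [e]
    refine intervalIntegral.integral_nonneg hcd fun s hs => mul_nonneg (hq s hs) ?_
    rw [sum_cycleWeight_mul_splineKer₃]
    exact mul_nonneg (by norm_num) (sum_cycleWeight_mul_cyclicPart_nonneg hB s ev)
  · rw [Finset.sum_congr rfl fun i _ => Finset.sum_comm]
    refine Finset.sum_nonneg fun i _ => Finset.sum_nonneg fun k _ => ?_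
    have h := mul_nonneg (div_nonneg (hq _ (hev i)) (by norm_num : (0 : ℝ) ≤ 6))
      -- The indicator of four equal nodes factors over the two paths from `i` to `k`, so the
      -- correction is again a sum of squares.
      (sum_cycleWeight_mul_path_nonneg hB i k fun j => if ev i = ev j ∧ ev i = ev k then 1 else 0)
    simp only [Finset.mul_sum] at h
    refine h.trans_eq (Finset.sum_congr rfl fun j _ => Finset.sum_congr rfl fun l _ => ?_)
    split_ifs <;> grind

end Positivity

/-! ### Derivatives of traces of powers along a matrix pencil -/

/-- The coefficient of `u ^ k` in `(M + u B) ^ N`, for non-commuting `M` and `B`. -/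
def pencilCoeff {R : Type*} [Ring R] (M B : R) : ℕ → ℕ → R
  | 0, N => M ^ N
  | _ + 1, 0 => 0
  | k + 1, N + 1 => M * pencilCoeff M B (k + 1) N + B * pencilCoeff M B k N

theorem map_pencilCoeff {R S : Type*} [Ring R] [Ring S] (φ : R →+* S) (M B : R) (k N : ℕ) :
    φ (pencilCoeff M B k N) = pencilCoeff (φ M) (φ B) k N := by
  induction N generalizing k with
  | zero => cases k <;> simp [pencilCoeff]
  | succ N ih => cases k <;> simp [pencilCoeff, ih]

section Pencil

variable {n : ℕ} (A B : Matrix (Fin n) (Fin n) ℂ)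

theorem hasDerivAt_pencil_apply (i j : Fin n) (t : ℝ) :
    HasDerivAt (fun t : ℝ => (A + t • B) i j) (B i j) t := by
  simpa using ((hasDerivAt_id t).smul_const (B i j)).const_add (A i j)

theorem hasDerivAt_mul_apply {P Q : ℝ → Matrix (Fin n) (Fin n) ℂ}
    {P' Q' : Matrix (Fin n) (Fin n) ℂ} {t : ℝ}
    (hP : ∀ i j, HasDerivAt (fun t => P t i j) (P' i j) t)
    (hQ : ∀ i j, HasDerivAt (fun t => Q t i j) (Q' i j) t) (i j : Fin n) :
    HasDerivAt (fun t => (P t * Q t) i j) ((P' * Q t + P t * Q') i j) t := by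
  simp only [Matrix.mul_apply, Matrix.add_apply, ← Finset.sum_add_distrib]
  exact HasDerivAt.fun_sum fun x _ => (hP i x).fun_mul (hQ x j)

/-- Shifting `t` shifts `u` in `(A + tB + uB)^N`, so differentiation sends the `k`-th Taylor
coefficient to `k + 1` times the next. Working entrywise requires no norm on matrices. -/
theorem hasDerivAt_pencilCoeff_apply (k N : ℕ) (t : ℝ) (i j : Fin n) :
    HasDerivAt (fun t : ℝ => pencilCoeff (A + t • B) B k N i j)
      ((((k + 1 : ℕ) : ℂ) • pencilCoeff (A + t • B) B (k + 1) N) i j) t := by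
  induction N generalizing k i j with
  | zero =>
    cases k with
    | zero => simpa [pencilCoeff] using hasDerivAt_const t ((1 : Matrix (Fin n) (Fin n) ℂ) i j)
    | succ k => simpa [pencilCoeff] using hasDerivAt_const t (0 : ℂ)
  | succ N ih =>
    have hM := fun i j => hasDerivAt_pencil_apply A B i j t
    cases k with
    | zero =>
      have h := hasDerivAt_mul_apply hM (ih 0) i j
      simp only [pencilCoeff, pow_succ'] at h ⊢
      refine h.congr_deriv ?_
      simp [add_comm]
    | succ k =>
      have h0 : ∀ i j : Fin n, HasDerivAt (fun _ : ℝ => B i j)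
        ((0 : Matrix (Fin n) (Fin n) ℂ) i j) t := fun i j => hasDerivAt_const t (B i j)
      have h := (hasDerivAt_mul_apply hM (ih (k + 1)) i j).fun_add
        (hasDerivAt_mul_apply h0 (ih k) i j)
      simp only [pencilCoeff]
      refine h.congr_deriv ?_
      simp only [Matrix.add_apply, Matrix.smul_apply, Matrix.mul_smul, zero_mul, Matrix.zero_apply,
        smul_eq_mul]
      push_cast
      ring

theorem hasDerivAt_trace_re {P : ℝ → Matrix (Fin n) (Fin n) ℂ}
    {P' : Matrix (Fin n) (Fin n) ℂ} {t : ℝ}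
    (hP : ∀ i j, HasDerivAt (fun t => P t i j) (P' i j) t) :
    HasDerivAt (fun t => (P t).trace.re) P'.trace.re t := by
  have h : HasDerivAt (fun t => (P t).trace) P'.trace t := by
    simpa [Matrix.trace] using HasDerivAt.fun_sum fun i (_ : i ∈ Finset.univ) => hP i i
  exact Complex.reCLM.hasFDerivAt.comp_hasDerivAt t h

theorem hasDerivAt_trace_mul_pencilCoeff (k N : ℕ) (t : ℝ) :
    HasDerivAt (fun t : ℝ => (B * pencilCoeff (A + t • B) B k N).trace.re)
      ((k + 1) * (B * pencilCoeff (A + t • B) B (k + 1) N).trace.re) t := by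
  have h0 : ∀ i j : Fin n, HasDerivAt (fun _ : ℝ => B i j)
    ((0 : Matrix (Fin n) (Fin n) ℂ) i j) t := fun i j => hasDerivAt_const t (B i j)
  refine (hasDerivAt_trace_re
    (hasDerivAt_mul_apply h0 (hasDerivAt_pencilCoeff_apply A B k N t))).congr_deriv ?_
  rw [zero_mul, zero_add, Matrix.mul_smul, Matrix.trace_smul, smul_eq_mul]
  have : (((k + 1 : ℕ) : ℂ)) = (((k + 1 : ℕ) : ℝ) : ℂ) := by push_cast; rfl
  rw [this, Complex.re_ofReal_mul]
  push_cast
  ring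

/-- The coefficient is the sum of the `N` words with one `B` and `N - 1` letters `M`, all with the
same trace after a cyclic shift. The factor `M ^ j` absorbs the letter moved around in the
induction; for `N = 0` the truncated exponent is multiplied by zero. -/
theorem trace_pencilCoeff_one_mul_pow (M B : Matrix (Fin n) (Fin n) ℂ) (N j : ℕ) :
    (pencilCoeff M B 1 N * M ^ j).trace = N * (B * M ^ (N - 1 + j)).trace := by
  induction N generalizing j with
  | zero => simp [pencilCoeff]
  | succ N ih =>
    have e : pencilCoeff M B 1 (N + 1) * M ^ j =
        M * (pencilCoeff M B 1 N * M ^ j) + B * M ^ (N + j) := by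
      simp only [pencilCoeff, pow_add]
      noncomm_ring
    rw [e, Matrix.trace_add, Matrix.trace_mul_comm, mul_assoc, ← pow_succ, ih]
    rcases N with _ | N
    · simp
    · have : N + 1 - 1 + (j + 1) = N + 1 + j := by omega
      rw [this, Nat.add_sub_cancel]
      push_cast
      ring

theorem hasDerivAt_trace_pow (N : ℕ) (t : ℝ) :
    HasDerivAt (fun t : ℝ => ((A + t • B) ^ N).trace.re)
      (N * (B * pencilCoeff (A + t • B) B 0 (N - 1)).trace.re) t := by
  have e : (fun t : ℝ => ((A + t • B) ^ N).trace.re) =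
      fun t : ℝ => (pencilCoeff (A + t • B) B 0 N).trace.re := by simp only [pencilCoeff]
  rw [e]
  refine (hasDerivAt_trace_re (hasDerivAt_pencilCoeff_apply A B 0 N t)).congr_deriv ?_
  have h := trace_pencilCoeff_one_mul_pow (A + t • B) B N 0
  rw [pow_zero, mul_one, add_zero] at h
  rw [zero_add, Nat.cast_one, one_smul, h, pencilCoeff, ← Complex.ofReal_natCast,
    Complex.re_ofReal_mul]

theorem sum_derivative_mul (p : ℝ[X]) (L : ℕ → ℝ) :
    (derivative p).sum (fun N a => a * L N) = p.sum fun N a => a * (N * L (N - 1)) := by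
  induction p using Polynomial.induction_on' with
  | add p q hp hq =>
    rw [derivative_add, Polynomial.sum_add_index _ _ _ (by simp) (by intros; ring),
      Polynomial.sum_add_index _ _ _ (by simp) (by intros; ring), hp, hq]
  | monomial N a =>
    rw [derivative_monomial, Polynomial.sum_monomial_index _ _ (by simp),
      Polynomial.sum_monomial_index _ _ (by simp)]
    ring

theorem traceFun_eval {M : Matrix (Fin n) (Fin n) ℂ} (hM : M.IsHermitian) (p : ℝ[X]) :
    traceFun (fun x => p.eval x) M = p.sum fun N a => a * (M ^ N).trace.re := by
  have hM' : IsSelfAdjoint M := hM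
  rw [traceFun, cfc_polynomial p M hM', aeval_eq_sum_range, Polynomial.sum_over_range _ (by simp),
    Matrix.trace_sum, Complex.re_sum]
  refine Finset.sum_congr rfl fun N _ => ?_
  rw [Matrix.trace_smul, Complex.smul_re, smul_eq_mul]

variable {A B}

theorem Matrix.IsHermitian.add_real_smul (hA : A.IsHermitian) (hB : B.IsHermitian) (t : ℝ) :
    (A + t • B).IsHermitian :=
  hA.add (hB.smul (IsSelfAdjoint.all t))

/-- One factor `B` is pulled out of the trace here, so that later only the third-order coefficient
of `p'` is needed. -/
theorem hasDerivAt_traceFun_eval (hA : A.IsHermitian) (hB : B.IsHermitian) (p : ℝ[X]) (t : ℝ) :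
    HasDerivAt (fun t : ℝ => traceFun (fun x => p.eval x) (A + t • B))
      ((derivative p).sum fun N a => a * (B * pencilCoeff (A + t • B) B 0 N).trace.re) t := by
  simp only [fun t => traceFun_eval (hA.add_real_smul hB t), sum_derivative_mul]
  exact HasDerivAt.fun_sum fun N _ => (hasDerivAt_trace_pow A B N t).const_mul _

theorem hasDerivAt_sum_trace_mul_pencilCoeff (q : ℝ[X]) (k : ℕ) (t : ℝ) :
    HasDerivAt (fun t : ℝ => q.sum fun N a => a * (B * pencilCoeff (A + t • B) B k N).trace.re)
      ((k + 1) * q.sum fun N a => a * (B * pencilCoeff (A + t • B) B (k + 1) N).trace.re) t := by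
  refine (HasDerivAt.fun_sum fun N _ =>
    (hasDerivAt_trace_mul_pencilCoeff A B k N t).const_mul (q.coeff N)).congr_deriv ?_
  rw [Polynomial.sum, Finset.mul_sum]
  exact Finset.sum_congr rfl fun N _ => by ring

theorem iteratedDeriv_succ_traceFun_eval (hA : A.IsHermitian) (hB : B.IsHermitian) (p : ℝ[X])
    (k : ℕ) :
    iteratedDeriv (k + 1) (fun t : ℝ => traceFun (fun x => p.eval x) (A + t • B)) =
      fun t => (k.factorial : ℝ) *
        (derivative p).sum fun N a => a * (B * pencilCoeff (A + t • B) B k N).trace.re := by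
  induction k with
  | zero =>
    funext t
    rw [zero_add, iteratedDeriv_one, (hasDerivAt_traceFun_eval hA hB p t).deriv]
    simp
  | succ k ih =>
    funext t
    rw [iteratedDeriv_succ, ih,
      ((hasDerivAt_sum_trace_mul_pencilCoeff (derivative p) k t).const_mul _).deriv,
      Nat.factorial_succ]
    push_cast
    ring

theorem contDiff_traceFun_eval (hA : A.IsHermitian) (hB : B.IsHermitian) (p : ℝ[X]) :
    ContDiff ℝ ∞ (fun t : ℝ => traceFun (fun x => p.eval x) (A + t • B)) := by
  refine contDiff_of_differentiable_iteratedDeriv fun m _ => ?_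
  rcases m with _ | k
  · rw [iteratedDeriv_zero]
    exact fun t => (hasDerivAt_traceFun_eval hA hB p t).differentiableAt
  · rw [iteratedDeriv_succ_traceFun_eval hA hB]
    exact fun t => ((hasDerivAt_sum_trace_mul_pencilCoeff _ k t).const_mul _).differentiableAt

/-! ### Pencil coefficients at a diagonal matrix -/

section Diagonal

variable (B) (ev : Fin n → ℝ)

theorem pencilCoeff_zero_diagonal_apply (N : ℕ) (i l : Fin n) :
    pencilCoeff (Matrix.diagonal fun i => (ev i : ℂ)) B 0 N i l =
      if i = l then (ev l : ℂ) ^ N else 0 := by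
  rw [pencilCoeff, Matrix.diagonal_pow, Matrix.diagonal_apply]
  split_ifs with h
  · simp [h]
  · rfl

/-- For diagonal `M` the recursion `M · + B ·` is, entry by entry, the recursion defining the
divided differences of `x ^ N`. -/
theorem pencilCoeff_one_diagonal_apply (N : ℕ) (i l : Fin n) :
    pencilCoeff (Matrix.diagonal fun i => (ev i : ℂ)) B 1 N i l =
      B i l * powDD₁ N (ev i) (ev l) := by
  induction N with
  | zero => simp [pencilCoeff, powDD₁]
  | succ N ih =>
    rw [pencilCoeff, Matrix.add_apply, Matrix.diagonal_mul, ih, Matrix.mul_apply]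
    simp only [pencilCoeff_zero_diagonal_apply, powDD₁]
    simp
    ring

theorem pencilCoeff_two_diagonal_apply (N : ℕ) (i l : Fin n) :
    pencilCoeff (Matrix.diagonal fun i => (ev i : ℂ)) B 2 N i l =
      ∑ j, B i j * B j l * powDD₂ N (ev i) (ev j) (ev l) := by
  induction N with
  | zero => simp [pencilCoeff, powDD₂]
  | succ N ih =>
    rw [pencilCoeff, Matrix.add_apply, Matrix.diagonal_mul, ih, Matrix.mul_apply, Finset.mul_sum,
      ← Finset.sum_add_distrib]
    refine Finset.sum_congr rfl fun j _ => ?_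
    rw [pencilCoeff_one_diagonal_apply, powDD₂]
    push_cast
    ring

theorem pencilCoeff_three_diagonal_apply (N : ℕ) (i l : Fin n) :
    pencilCoeff (Matrix.diagonal fun i => (ev i : ℂ)) B 3 N i l =
      ∑ j, ∑ k, B i j * B j k * B k l * powDD₃ N (ev i) (ev j) (ev k) (ev l) := by
  induction N with
  | zero => simp [pencilCoeff, powDD₃]
  | succ N ih =>
    rw [pencilCoeff, Matrix.add_apply, Matrix.diagonal_mul, ih, Matrix.mul_apply, Finset.mul_sum,
      ← Finset.sum_add_distrib]
    refine Finset.sum_congr rfl fun j _ => ?_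
    rw [pencilCoeff_two_diagonal_apply, Finset.mul_sum, Finset.mul_sum, ← Finset.sum_add_distrib]
    refine Finset.sum_congr rfl fun k _ => ?_
    rw [powDD₃]
    push_cast
    ring

theorem trace_mul_pencilCoeff_three_diagonal (N : ℕ) :
    (B * pencilCoeff (Matrix.diagonal fun i => (ev i : ℂ)) B 3 N).trace.re =
      ∑ i, ∑ j, ∑ k, ∑ l, cycleWeight B i j k l * powDD₃ N (ev i) (ev j) (ev k) (ev l) := by
  rw [Matrix.trace_mul_comm, Matrix.trace, Complex.re_sum]
  refine Finset.sum_congr rfl fun i _ => ?_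
  rw [Matrix.diag_apply, Matrix.mul_apply]
  simp only [pencilCoeff_three_diagonal_apply, Finset.sum_mul, Complex.re_sum]
  rw [Finset.sum_comm]
  refine Finset.sum_congr rfl fun j _ => ?_
  rw [Finset.sum_comm]
  refine Finset.sum_congr rfl fun k _ => Finset.sum_congr rfl fun l _ => ?_
  rw [cycleWeight, mul_comm (Complex.re _), ← Complex.re_ofReal_mul]
  congr 1
  ring

end Diagonal

/-- The fourth derivative of `t ↦ tr p(A + t B)` is non-negative wherever the spectrum of `A + t B`
lies in an interval on which `p` has a non-negative fourth derivative. -/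
theorem iteratedDeriv_four_traceFun_eval_nonneg (hA : A.IsHermitian) (hB : B.IsHermitian)
    {p : ℝ[X]} {c d : ℝ} (hp : ∀ x ∈ Set.Icc c d, 0 ≤ (derivative^[4] p).eval x) {t : ℝ}
    (ht : spectrum ℝ (A + t • B) ⊆ Set.Icc c d) :
    0 ≤ iteratedDeriv 4 (fun t : ℝ => traceFun (fun x => p.eval x) (A + t • B)) t := by
  rw [iteratedDeriv_succ_traceFun_eval hA hB p 3]
  refine mul_nonneg (by positivity) ?_
  have hM := hA.add_real_smul hB t
  set M := A + t • B
  -- Pass to an eigenbasis of `M`: conjugation preserves the trace, the pencil coefficients and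
  -- hermiticity of `B`.
  set φ := Unitary.conjStarAlgAut ℂ (Matrix (Fin n) (Fin n) ℂ) hM.eigenvectorUnitary with hφ
  set D : Matrix (Fin n) (Fin n) ℂ := Matrix.diagonal fun i => (hM.eigenvalues i : ℂ) with hD
  have hMD : M = φ D := hM.spectral_theorem
  obtain ⟨B', hB'⟩ : ∃ B', φ B' = B := φ.surjective B
  have hBH : B'.IsHermitian := by
    have : φ (star B') = φ B' := by rw [map_star, hB']; exact hB
    exact φ.injective this
  have key (N : ℕ) : (B * pencilCoeff M B 3 N).trace = (B' * pencilCoeff D B' 3 N).trace := by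
    have h := map_pencilCoeff (φ : Matrix (Fin n) (Fin n) ℂ →+* Matrix (Fin n) (Fin n) ℂ) D B' 3 N
    simp only [RingHom.coe_coe] at h
    rw [hMD, ← hB', ← h, ← map_mul, hφ, Unitary.conjStarAlgAut_apply, Matrix.trace_mul_comm,
      ← mul_assoc, Unitary.coe_star_mul_self, one_mul]
  simp only [key, hD, trace_mul_pencilCoeff_three_diagonal]
  have h := sum_cycleWeight_mul_polyDD₃_nonneg hBH hM.eigenvalues
    (fun i => ht (hM.eigenvalues_mem_spectrum_real i)) (derivative p) hp
  refine h.trans_eq ?_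
  simp only [polyDD₃, Polynomial.sum, Finset.mul_sum]
  simp only [Finset.sum_comm (t := (derivative p).support)]
  refine Finset.sum_congr rfl fun N _ => Finset.sum_congr rfl fun i _ =>
    Finset.sum_congr rfl fun j _ => Finset.sum_congr rfl fun k _ =>
    Finset.sum_congr rfl fun l _ => ?_
  ring

end Pencil

/-! ### Approximation of functions with non-negative distributional derivatives -/

theorem contDiff_fwdDiff_iterate {g : ℝ → ℝ} (hg : ContDiff ℝ ∞ g) (h : ℝ) (k : ℕ) :
    ContDiff ℝ ∞ ((fwdDiff h)^[k] g) := by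
  induction k with
  | zero => exact hg
  | succ k ih =>
    rw [Function.iterate_succ_apply']
    exact (ih.comp (contDiff_id.add contDiff_const)).sub ih

theorem deriv_fwdDiff_iterate {g : ℝ → ℝ} (hg : ContDiff ℝ ∞ g) (h : ℝ) (k : ℕ) :
    deriv ((fwdDiff h)^[k] g) = (fwdDiff h)^[k] (deriv g) := by
  induction k with
  | zero => rfl
  | succ k ih =>
    rw [Function.iterate_succ_apply', Function.iterate_succ_apply', ← ih]
    funext x
    have hd : Differentiable ℝ ((fwdDiff h)^[k] g) :=
      (contDiff_fwdDiff_iterate hg h k).differentiable (by simp)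
    change deriv (fun y => (fwdDiff h)^[k] g (y + h) - (fwdDiff h)^[k] g y) x = _
    rw [deriv_fun_sub (by fun_prop) (by fun_prop), deriv_comp_add_const]
    rfl

/-- By induction, `Δᵏ g` has derivative `Δᵏ g' ≥ 0`, hence increases from `x` to `x + h`. -/
theorem fwdDiff_iterate_nonneg {c d h : ℝ} (hh : 0 ≤ h) (k : ℕ) {g : ℝ → ℝ}
    (hg : ContDiff ℝ ∞ g) (hgk : ∀ x ∈ Set.Icc c d, 0 ≤ iteratedDeriv k g x) {x : ℝ}
    (hc : c ≤ x) (hd : x + k * h ≤ d) : 0 ≤ (fwdDiff h)^[k] g x := by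
  induction k generalizing g x with
  | zero => simpa using hgk x ⟨hc, by simpa using hd⟩
  | succ k ih =>
    rw [Function.iterate_succ_apply']
    have hmono : MonotoneOn ((fwdDiff h)^[k] g) (Set.Icc x (x + h)) := by
      refine monotoneOn_of_deriv_nonneg (convex_Icc _ _)
        (contDiff_fwdDiff_iterate hg h k).continuous.continuousOn
        ((contDiff_fwdDiff_iterate hg h k).differentiable (by simp)).differentiableOn
        fun y hy => ?_
      rw [interior_Icc] at hy
      rw [deriv_fwdDiff_iterate hg]
      refine ih (contDiff_infty_iff_deriv.1 hg).2 (fun z hz => ?_) (hc.trans hy.1.le) ?_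
      · rw [← iteratedDeriv_succ']
        exact hgk z hz
      · push_cast at hd
        linarith [hy.2]
    have := hmono (Set.left_mem_Icc.2 (by linarith)) (Set.right_mem_Icc.2 (by linarith))
      (by linarith : x ≤ x + h)
    simpa [fwdDiff] using this

theorem integral_abs_comp_le {g : ℝ → ℝ} (hg : Integrable g) (x η : ℝ) (hη : 0 ≤ η) {j : ℝ}
    (hj : 1 ≤ |j|) :
    ∫ h in (0 : ℝ)..η, |g (x + j * h)| ≤ ∫ y, |g y| := by
  have hj0 : j ≠ 0 := by rintro rfl; norm_num at hj
  have hi : Integrable fun h => |g (x + j * h)| :=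
    ((hg.comp_add_left x).comp_mul_left' hj0).abs
  rw [intervalIntegral.integral_of_le hη]
  refine (setIntegral_le_integral hi (Filter.Eventually.of_forall fun _ => abs_nonneg _)).trans ?_
  rw [Measure.integral_comp_mul_left (fun y => |g (x + y)|) j,
    integral_add_left_eq_self (fun y => |g y|) x, abs_inv, smul_eq_mul]
  exact mul_le_of_le_one_left (integral_nonneg fun _ => abs_nonneg _) (inv_le_one_of_one_le₀ hj)

/-- A function whose fourth derivative is non-negative is bounded in the interior by its
`L¹` norm. -/
theorem abs_le_integral_abs_of_iteratedDeriv_four_nonneg {g : ℝ → ℝ} (hg : ContDiff ℝ ∞ g)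
    (hgi : Integrable g) {c d η : ℝ} (hη : 0 < η)
    (hg4 : ∀ x ∈ Set.Icc (c - 3 * η) (d + 3 * η), 0 ≤ iteratedDeriv 4 g x) {x : ℝ}
    (hx : x ∈ Set.Icc c d) : |g x| ≤ 3 / η * ∫ y, |g y| := by
  have hcont : Continuous g := hg.continuous
  have avg (j : ℝ) (hj : 1 ≤ |j|) := integral_abs_comp_le hgi x η hη.le hj
  have ii (j : ℝ) : IntervalIntegrable (fun h => |g (x + j * h)|) volume 0 η :=
    Continuous.intervalIntegrable (by fun_prop) _ _
  set S := ∫ y, |g y|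
  -- The fourth difference starting at `x - 2h` gives `g x` the coefficient `6`; the one starting at
  -- `x - h`, used for `upper`, gives it `-4`. Integrating over `h` bounds the right sides by `10 S`
  -- and `12 S`, whence `3 / η`.
  have lower : ∀ h ∈ Set.Icc 0 η, -6 * g x ≤ |g (x + (-2) * h)| + 4 * |g (x + (-1) * h)| +
      4 * |g (x + 1 * h)| + |g (x + 2 * h)| := by
    intro h hh
    have := fwdDiff_iterate_nonneg hh.1 4 hg hg4 (x := x + (-2) * h) (by linarith [hh.2, hx.1])
      (by push_cast; linarith [hh.2, hx.2])
    simp only [Function.iterate_succ, Function.iterate_zero, Function.comp_apply, fwdDiff,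
      id_eq] at this
    have e1 : x + -2 * h + h = x + (-1) * h := by ring
    have e2 : x + (-1) * h + h = x := by ring
    have e3 : x + h = x + 1 * h := by ring
    have e4 : x + 1 * h + h = x + 2 * h := by ring
    rw [e1, e2, e3, e4] at this
    linarith [le_abs_self (g (x + (-2) * h)), neg_abs_le (g (x + (-1) * h)),
      neg_abs_le (g (x + 1 * h)), le_abs_self (g (x + 2 * h))]
  have upper : ∀ h ∈ Set.Icc 0 η, 4 * g x ≤ |g (x + (-1) * h)| + 6 * |g (x + 1 * h)| +
      4 * |g (x + 2 * h)| + |g (x + 3 * h)| := by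
    intro h hh
    have := fwdDiff_iterate_nonneg hh.1 4 hg hg4 (x := x + (-1) * h) (by linarith [hh.2, hx.1])
      (by push_cast; linarith [hh.2, hx.2])
    simp only [Function.iterate_succ, Function.iterate_zero, Function.comp_apply, fwdDiff,
      id_eq] at this
    have e2 : x + (-1) * h + h = x := by ring
    have e3 : x + h = x + 1 * h := by ring
    have e4 : x + 1 * h + h = x + 2 * h := by ring
    have e5 : x + 2 * h + h = x + 3 * h := by ring
    rw [e2, e3, e4, e5] at this
    linarith [le_abs_self (g (x + (-1) * h)), le_abs_self (g (x + 1 * h)),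
      neg_abs_le (g (x + 2 * h)), le_abs_self (g (x + 3 * h))]
  have L := intervalIntegral.integral_mono_on hη.le intervalIntegrable_const
    ((((ii (-2)).add ((ii (-1)).const_mul 4)).add ((ii 1).const_mul 4)).add (ii 2)) lower
  have U := intervalIntegral.integral_mono_on hη.le intervalIntegrable_const
    ((((ii (-1)).add ((ii 1).const_mul 6)).add ((ii 2).const_mul 4)).add (ii 3)) upper
  rw [intervalIntegral.integral_add
      (((ii (-2)).add ((ii (-1)).const_mul 4)).add ((ii 1).const_mul 4)) (ii 2),
    intervalIntegral.integral_add ((ii (-2)).add ((ii (-1)).const_mul 4)) ((ii 1).const_mul 4),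
    intervalIntegral.integral_add (ii (-2)) ((ii (-1)).const_mul 4),
    intervalIntegral.integral_const] at L
  rw [intervalIntegral.integral_add
      (((ii (-1)).add ((ii 1).const_mul 6)).add ((ii 2).const_mul 4)) (ii 3),
    intervalIntegral.integral_add ((ii (-1)).add ((ii 1).const_mul 6)) ((ii 2).const_mul 4),
    intervalIntegral.integral_add (ii (-1)) ((ii 1).const_mul 6),
    intervalIntegral.integral_const] at U
  simp only [intervalIntegral.integral_const_mul, sub_zero, smul_eq_mul] at L U
  have a1 := avg 1 (by norm_num)
  have a2 := avg 2 (by norm_num)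
  have a3 := avg 3 (by norm_num)
  have b1 := avg (-1) (by norm_num)
  have b2 := avg (-2) (by norm_num)
  have hS : 0 ≤ S := integral_nonneg fun _ => abs_nonneg _
  rw [div_mul_eq_mul_div]
  refine abs_le.2 ⟨?_, (le_div_iff₀ hη).2 (by linarith)⟩
  rw [neg_le, le_div_iff₀ hη]
  linarith

theorem exists_polynomial_derivative_eq (q : ℝ[X]) : ∃ p : ℝ[X], derivative p = q := by
  induction q using Polynomial.induction_on' with
  | add p q hp hq =>
    obtain ⟨p', rfl⟩ := hp
    obtain ⟨q', rfl⟩ := hq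
    exact ⟨p' + q', derivative_add⟩
  | monomial N a =>
    refine ⟨monomial (N + 1) (a / (N + 1)), ?_⟩
    rw [derivative_monomial, Nat.add_sub_cancel]
    congr 1
    push_cast
    field_simp

/-- A smooth function with non-negative `k`-th derivative on a compact interval is uniformly
approximated there by polynomials with the same property. -/
theorem exists_polynomial_near_of_iteratedDeriv_nonneg {c d : ℝ} (hcd : c ≤ d) (k : ℕ) {g : ℝ → ℝ}
    (hg : ContDiff ℝ ∞ g) (hgk : ∀ x ∈ Set.Icc c d, 0 ≤ iteratedDeriv k g x) {ε : ℝ}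
    (hε : 0 < ε) :
    ∃ p : ℝ[X], (∀ x ∈ Set.Icc c d, 0 ≤ (derivative^[k] p).eval x) ∧
      ∀ x ∈ Set.Icc c d, |p.eval x - g x| ≤ ε := by
  induction k generalizing g ε with
  | zero =>
    obtain ⟨p, hp⟩ := exists_polynomial_near_of_continuousOn c d g hg.continuous.continuousOn
      (ε / 2) (by positivity)
    -- The upward shift by `ε / 2` restores non-negativity lost to the approximation error.
    refine ⟨p + C (ε / 2), fun x hx => ?_, fun x hx => ?_⟩
    · have h1 := abs_lt.1 (hp x hx)
      have h2 := hgk x hx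
      simp only [iteratedDeriv_zero] at h2
      simp only [Function.iterate_zero, id_eq, eval_add, eval_C]
      linarith [h1.1]
    · have h1 := abs_lt.1 (hp x hx)
      simp only [eval_add, eval_C]
      exact abs_le.2 ⟨by linarith [h1.1], by linarith [h1.2]⟩
  | succ k ih =>
    obtain ⟨q, hq1, hq2⟩ := ih (contDiff_infty_iff_deriv.1 hg).2
      (fun x hx => by rw [← iteratedDeriv_succ']; exact hgk x hx)
      (show 0 < ε / (d - c + 1) from div_pos hε (by linarith))
    obtain ⟨p, rfl⟩ := exists_polynomial_derivative_eq q
    -- Match the values at `c`; the mean value inequality then costs a factor at most `d - c`.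
    refine ⟨p + C (g c - p.eval c), fun x hx => ?_, fun x hx => ?_⟩
    · rw [Function.iterate_succ_apply, derivative_add, derivative_C, add_zero]
      exact hq1 x hx
    · have hd (y : ℝ) : HasDerivAt (fun y => p.eval y - g y)
          ((derivative p).eval y - deriv g y) y :=
        (p.hasDerivAt y).sub ((hg.differentiable (by simp)) y).hasDerivAt
      have h := (convex_Icc c d).norm_image_sub_le_of_norm_hasDerivWithin_le
        (fun y _ => (hd y).hasDerivWithinAt) hq2 (Set.left_mem_Icc.2 hcd) hx
      simp only [eval_add, eval_C, Real.norm_eq_abs] at h ⊢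
      have e : p.eval x + (g c - p.eval c) - g x = p.eval x - g x - (p.eval c - g c) := by ring
      rw [e]
      refine h.trans ?_
      rw [abs_of_nonneg (sub_nonneg.2 hx.1), div_mul_eq_mul_div, div_le_iff₀ (by linarith)]
      exact mul_le_mul_of_nonneg_left (by linarith [hx.2]) hε.le

theorem tsupport_iteratedDeriv_subset (k : ℕ) (g : ℝ → ℝ) :
    tsupport (iteratedDeriv k g) ⊆ tsupport g := by
  induction k with
  | zero => simp
  | succ k ih =>
    rw [iteratedDeriv_succ]
    exact tsupport_deriv_subset.trans ih

/-! ### Mollification -/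

section Mollify

open ContinuousLinearMap
open scoped Convolution

theorem iteratedDeriv_convolution_left {ρ F : ℝ → ℝ} (hρ : ContDiff ℝ ∞ ρ)
    (hρc : HasCompactSupport ρ) (hF : LocallyIntegrable F) (k : ℕ) :
    iteratedDeriv k (ρ ⋆[lsmul ℝ ℝ] F) = (iteratedDeriv k ρ) ⋆[lsmul ℝ ℝ] F := by
  induction k generalizing ρ with
  | zero => simp
  | succ k ih =>
    rw [iteratedDeriv_succ', iteratedDeriv_succ',
      ← ih (contDiff_infty_iff_deriv.1 hρ).2 hρc.deriv]
    congr 1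
    funext x
    exact (hρc.hasDerivAt_convolution_left _ (hρ.of_le (by simp)) hF x).deriv

theorem integrable_convolution_of_integrable {ρ F : ℝ → ℝ} (hρ : Integrable ρ)
    (hF : Integrable F) : Integrable (ρ ⋆[lsmul ℝ ℝ] F) :=
  hρ.integrable_convolution _ hF

theorem integral_abs_convolution_le {ρ F : ℝ → ℝ} (hρ : Integrable ρ) (hρ0 : ∀ x, 0 ≤ ρ x)
    (hρ1 : ∫ x, ρ x = 1) (hF : Integrable F) :
    ∫ x, |(ρ ⋆[lsmul ℝ ℝ] F) x| ≤ ∫ x, |F x| := by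
  have h := integral_convolution (lsmul ℝ ℝ : ℝ →L[ℝ] ℝ →L[ℝ] ℝ) (μ := volume) (ν := volume)
    hρ hF.abs
  rw [hρ1] at h
  simp only [lsmul_apply, one_smul] at h
  rw [← h]
  refine integral_mono (hρ.integrable_convolution _ hF).abs (hρ.integrable_convolution _ hF.abs)
    fun x => ?_
  simp only [convolution_lsmul]
  refine (abs_integral_le_integral_abs).trans_eq (integral_congr_ae (Filter.Eventually.of_forall
    fun t => ?_))
  simp [abs_mul, abs_of_nonneg (hρ0 t)]

/-- The mollification of `f`, cut off to a neighbourhood of the point `x`, has a non-negative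
`k`-th derivative at `x` if `f` has a non-negative `k`-th distributional derivative. -/
theorem iteratedDeriv_convolution_nonneg {k : ℕ} (hk : Even k) {f : ℝ → ℝ} {U : Set ℝ}
    (hU : IsOpen U) (hf : HasNonnegDistribDeriv k f U) {ρ : ℝ → ℝ} (hρ : ContDiff ℝ ∞ ρ)
    (hρ0 : ∀ x, 0 ≤ ρ x) {r : ℝ} (hρr : tsupport ρ ⊆ Metric.closedBall 0 r) {K : Set ℝ}
    (hKU : K ⊆ U) (hF : LocallyIntegrable (K.indicator f)) {x : ℝ}
    (hx : Metric.closedBall x r ⊆ K) :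
    0 ≤ iteratedDeriv k (ρ ⋆[lsmul ℝ ℝ] K.indicator f) x := by
  have hρc : HasCompactSupport ρ :=
    (isCompact_closedBall (0 : ℝ) r).of_isClosed_subset (isClosed_tsupport ρ) hρr
  -- The derivative of the convolution at `x` is the distributional pairing with this reflected
  -- bump; for even `k` the reflection introduces no sign.
  set φ : ℝ → ℝ := fun y => ρ (x - y) with hφ
  have hφs : tsupport φ ⊆ Metric.closedBall x r := by
    have h1 : Function.support φ ⊆ Metric.closedBall x r := by
      intro y hy
      have : x - y ∈ Metric.closedBall (0 : ℝ) r := hρr (subset_tsupport ρ hy)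
      rw [mem_closedBall_zero_iff, Real.norm_eq_abs] at this
      rwa [Metric.mem_closedBall, Real.dist_eq, abs_sub_comm]
    exact closure_minimal h1 Metric.isClosed_closedBall
  have hφc : HasCompactSupport φ :=
    (isCompact_closedBall x r).of_isClosed_subset (isClosed_tsupport φ) hφs
  have h := hf.nonneg φ (hρ.comp (contDiff_const.sub contDiff_id)) hφc
    ((hφs.trans hx).trans hKU) fun y => hρ0 _
  rw [hk.neg_one_pow, one_mul] at h
  refine h.trans_eq ?_
  rw [iteratedDeriv_convolution_left hρ hρc hF, convolution_lsmul_swap,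
    ← integral_indicator hU.measurableSet]
  refine integral_congr_ae (Filter.Eventually.of_forall fun y => ?_)
  have hder : iteratedDeriv k φ y = iteratedDeriv k ρ (x - y) := by
    rw [hφ, iteratedDeriv_comp_const_sub]
    simp [hk.neg_one_pow]
  have hzero : y ∉ K → iteratedDeriv k ρ (x - y) = 0 := by
    intro hy
    rw [← hder]
    by_contra hne
    exact hy (hx (hφs (tsupport_iteratedDeriv_subset k φ (subset_tsupport _ hne))))
  by_cases hy : y ∈ K
  · simp [hy, hKU hy, hder, mul_comm]
  · by_cases hyU : y ∈ U <;> simp [hy, hyU, hder, hzero hy]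

theorem exists_Icc_thickening_subset {U : Set ℝ} (hU : IsOpen U) {c d : ℝ} (hcd : c ≤ d)
    (h : Set.Icc c d ⊆ U) : ∃ η > 0, Set.Icc (c - η) (d + η) ⊆ U := by
  obtain ⟨ε₁, h₁, hb₁⟩ := Metric.isOpen_iff.1 hU c (h (Set.left_mem_Icc.2 hcd))
  obtain ⟨ε₂, h₂, hb₂⟩ := Metric.isOpen_iff.1 hU d (h (Set.right_mem_Icc.2 hcd))
  refine ⟨min ε₁ ε₂ / 2, by positivity, fun x hx => ?_⟩
  have m1 := min_le_left ε₁ ε₂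
  have m2 := min_le_right ε₁ ε₂
  rcases lt_or_ge x c with hxc | hxc
  · refine hb₁ ?_
    rw [Metric.mem_ball, Real.dist_eq, abs_lt]
    constructor <;> linarith [hx.1]
  · rcases le_or_gt x d with hxd | hxd
    · exact h ⟨hxc, hxd⟩
    · refine hb₂ ?_
      rw [Metric.mem_ball, Real.dist_eq, abs_lt]
      constructor <;> linarith [hx.2]

/-- On a compact interval, a function with non-negative fourth distributional derivative is the
almost everywhere limit of a bounded sequence of polynomials with non-negative fourth
derivatives. -/
theorem HasNonnegDistribDeriv.exists_polynomial_tendsto {f : ℝ → ℝ} {U : Set ℝ} (hU : IsOpen U)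
    (hf : HasNonnegDistribDeriv 4 f U) {c d : ℝ} (hcdU : Set.Icc c d ⊆ U) :
    ∃ (p : ℕ → ℝ[X]) (M : ℝ),
      (∀ m, ∀ x ∈ Set.Icc c d, 0 ≤ (derivative^[4] (p m)).eval x) ∧
      (∀ m, ∀ x ∈ Set.Icc c d, |(p m).eval x| ≤ M) ∧
      ∀ᵐ x, x ∈ Set.Icc c d →
        Filter.Tendsto (fun m => (p m).eval x) Filter.atTop (nhds (f x)) := by
  rcases lt_or_ge d c with hdc | hcd
  · refine ⟨fun _ => 0, 0, ?_⟩
    simp [Set.Icc_eq_empty_of_lt hdc]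
  obtain ⟨δ, hδ, hδU⟩ := exists_Icc_thickening_subset hU hcd hcdU
  -- A margin `3η` for the fourth differences and `η` for the mollifier's radius.
  set η := δ / 4 with hη
  have hη0 : 0 < η := by positivity
  set K := Set.Icc (c - δ) (d + δ) with hK
  set F := K.indicator f with hFdef
  have hFi : Integrable F :=
    (integrable_indicator_iff measurableSet_Icc).2
      (hf.locallyIntegrableOn.integrableOn_compact_subset hδU isCompact_Icc)
  let φ : ℕ → ContDiffBump (0 : ℝ) := fun m =>
    { rIn := η / (2 * (m + 1)), rOut := η / (m + 1), rIn_pos := by positivity,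
      rIn_lt_rOut := by
        have : (0 : ℝ) < m + 1 := by positivity
        exact div_lt_div_of_pos_left hη0 this (by linarith) }
  have hφlim : Filter.Tendsto (fun m => (φ m).rOut) Filter.atTop (nhds 0) :=
    tendsto_const_div_atTop_nhds_zero_nat η |>.comp (Filter.tendsto_add_atTop_nat 1) |>.congr
      fun m => by simp [φ]
  have hφle (m : ℕ) : (φ m).rOut ≤ η := by
    simp only [φ]
    exact div_le_self hη0.le (by linarith [(Nat.cast_nonneg m : (0 : ℝ) ≤ m)])
  let ρ : ℕ → ℝ → ℝ := fun m => (φ m).normed volume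
  have hρ (m : ℕ) : ContDiff ℝ ∞ (ρ m) := (φ m).contDiff_normed
  have hρc (m : ℕ) : HasCompactSupport (ρ m) := (φ m).hasCompactSupport_normed
  have hρi (m : ℕ) : Integrable (ρ m) := (hρ m).continuous.integrable_of_hasCompactSupport (hρc m)
  let g : ℕ → ℝ → ℝ := fun m => ρ m ⋆[lsmul ℝ ℝ] F
  have hg (m : ℕ) : ContDiff ℝ ∞ (g m) :=
    (hρc m).contDiff_convolution_left _ (hρ m) hFi.locallyIntegrable
  have hg4 (m : ℕ) : ∀ x ∈ Set.Icc (c - 3 * η) (d + 3 * η), 0 ≤ iteratedDeriv 4 (g m) x := by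
    intro x hx
    refine iteratedDeriv_convolution_nonneg (by decide) hU hf (hρ m) (φ m).nonneg_normed
      (r := η) ?_ hδU hFi.locallyIntegrable ?_
    · rw [(φ m).tsupport_normed_eq]
      exact Metric.closedBall_subset_closedBall (hφle m)
    · rw [Real.closedBall_eq_Icc]
      exact Set.Icc_subset_Icc (by linarith [hx.1]) (by linarith [hx.2])
  have hgb (m : ℕ) : ∀ x ∈ Set.Icc c d, |g m x| ≤ 3 / η * ∫ y, |F y| := by
    intro x hx
    refine (abs_le_integral_abs_of_iteratedDeriv_four_nonneg (hg m)
      (integrable_convolution_of_integrable (hρi m) hFi) hη0 (hg4 m) hx).trans ?_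
    exact mul_le_mul_of_nonneg_left (integral_abs_convolution_le (hρi m) (φ m).nonneg_normed
      (φ m).integral_normed hFi) (by positivity)
  have hgl : ∀ᵐ x, Filter.Tendsto (fun m => g m x) Filter.atTop (nhds (F x)) :=
    ContDiffBump.ae_convolution_tendsto_right_of_locallyIntegrable (K := 2) hφlim
      (Filter.Eventually.of_forall fun m => by
        simp only [φ]
        apply le_of_eq
        field_simp) hFi.locallyIntegrable
  have hpos (m : ℕ) : (0 : ℝ) < 1 / ((m : ℝ) + 1) := Nat.one_div_pos_of_nat
  choose p hp1 hp2 using fun m : ℕ => exists_polynomial_near_of_iteratedDeriv_nonneg hcd 4 (hg m)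
    (fun x hx => hg4 m x ⟨by linarith [hx.1], by linarith [hx.2]⟩) (hpos m)
  refine ⟨p, 1 + 3 / η * ∫ y, |F y|, hp1, fun m x hx => ?_, ?_⟩
  · have h1 : |(p m).eval x - g m x| ≤ 1 := (hp2 m x hx).trans
      ((div_le_one (by positivity)).2 (by linarith [(Nat.cast_nonneg m : (0 : ℝ) ≤ m)]))
    calc |(p m).eval x| = |((p m).eval x - g m x) + g m x| := by ring_nf
      _ ≤ _ := (abs_add_le _ _).trans (add_le_add h1 (hgb m x hx))
  · filter_upwards [hgl] with x hx hxcd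
    have hFx : F x = f x :=
      Set.indicator_of_mem (show x ∈ K from ⟨by linarith [hxcd.1], by linarith [hxcd.2]⟩) f
    rw [hFx] at hx
    have h0 : Filter.Tendsto (fun m => (p m).eval x - g m x) Filter.atTop (nhds 0) :=
      squeeze_zero_norm (fun m => hp2 m x hxcd) tendsto_one_div_add_atTop_nhds_zero_nat
    simpa using h0.add hx

end Mollify

/-! ### Eigenvalues of a pencil and null sets -/

/-- On `G` the first coordinate is a Lipschitz function of the second, and Lipschitz maps preserve
null sets of the line. -/
theorem volume_fst_image_eq_zero_of_dist_le {G : Set (ℝ × ℝ)} {K : NNReal}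
    (h : ∀ w ∈ G, ∀ w' ∈ G, dist w.1 w'.1 ≤ K * dist w.2 w'.2)
    (hG : volume (Prod.snd '' G) = 0) : volume (Prod.fst '' G) = 0 := by
  set f : ℝ → ℝ := fun y => (Function.invFunOn Prod.snd G y).1 with hf
  have hmem {y : ℝ} (hy : y ∈ Prod.snd '' G) : Function.invFunOn Prod.snd G y ∈ G :=
    Function.invFunOn_mem hy
  have heq {y : ℝ} (hy : y ∈ Prod.snd '' G) : (Function.invFunOn Prod.snd G y).2 = y :=
    Function.invFunOn_eq hy
  have hlip : LipschitzOnWith K f (Prod.snd '' G) := by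
    refine LipschitzOnWith.of_dist_le_mul fun y hy y' hy' => ?_
    have := h _ (hmem hy) _ (hmem hy')
    rwa [heq hy, heq hy'] at this
  have hsub : Prod.fst '' G ⊆ f '' (Prod.snd '' G) := by
    rintro _ ⟨w, hw, rfl⟩
    have hy : w.2 ∈ Prod.snd '' G := ⟨w, hw, rfl⟩
    refine ⟨w.2, hy, ?_⟩
    have := h _ (hmem hy) _ hw
    rw [heq hy, dist_self, mul_zero] at this
    exact dist_le_zero.1 this
  refine measure_mono_null hsub ?_
  rw [← hausdorffMeasure_real] at hG ⊢
  have := hlip.hausdorffMeasure_image_le (d := 1) zero_le_one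
  rw [hG, mul_zero] at this
  exact le_antisymm this bot_le

theorem contDiff_evalEval (Q : ℂ[X][X]) :
    ContDiff ℝ ∞ fun w : ℝ × ℝ => Q.evalEval (w.2 : ℂ) (w.1 : ℂ) := by
  have h1 : ContDiff ℝ ∞ fun w : ℝ × ℝ => (w.1 : ℂ) :=
    Complex.ofRealCLM.contDiff.comp contDiff_fst
  have h2 : ContDiff ℝ ∞ fun w : ℝ × ℝ => (w.2 : ℂ) :=
    Complex.ofRealCLM.contDiff.comp contDiff_snd
  have h3 (q : ℂ[X]) : ContDiff ℝ ∞ fun w : ℝ × ℝ => q.eval (w.2 : ℂ) := by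
    simp only [eval_eq_sum_range]
    exact ContDiff.sum fun i _ => contDiff_const.mul (h2.pow i)
  have e : (fun w : ℝ × ℝ => Q.evalEval (w.2 : ℂ) (w.1 : ℂ)) =
      fun w => ∑ i ∈ Finset.range (Q.natDegree + 1), (Q.coeff i).eval (w.2 : ℂ) * (w.1 : ℂ) ^ i := by
    funext w
    rw [evalEval, eval_eq_sum_range (p := Q), eval_finsetSum]
    simp
  rw [e]
  exact ContDiff.sum fun i _ => (h3 _).mul (h1.pow i)

theorem evalEval_eq_eval_map (Q : ℂ[X][X]) (x y : ℂ) :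
    Q.evalEval x y = (Q.map (evalRingHom x)).eval y := by
  rw [evalEval, eval_map, eval_eq_sum_range (p := Q), eval₂_eq_sum_range, eval_finsetSum]
  simp

theorem hasDerivAt_evalEval (Q : ℂ[X][X]) (x : ℂ) (t : ℝ) :
    HasDerivAt (fun t : ℝ => Q.evalEval x (t : ℂ)) ((derivative Q).evalEval x (t : ℂ)) t := by
  simp only [evalEval_eq_eval_map, ← derivative_map]
  exact ((Q.map (evalRingHom x)).hasDerivAt (t : ℂ)).comp_ofReal

/-- Here `w = (t, x)` and `derivative Q` is `∂Q/∂t`. Where it is non-zero, strict differentiability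
makes `t` locally a Lipschitz function of `x` on the zero set; countably many such neighbourhoods
suffice. No implicit function is required. -/
theorem volume_fst_image_simple_zeros (Q : ℂ[X][X]) {Z : Set ℝ} (hZ : volume Z = 0) :
    volume (Prod.fst '' {w : ℝ × ℝ | w.2 ∈ Z ∧ Q.evalEval (w.2 : ℂ) (w.1 : ℂ) = 0 ∧
      (derivative Q).evalEval (w.2 : ℂ) (w.1 : ℂ) ≠ 0}) = 0 := by
  set S := {w : ℝ × ℝ | w.2 ∈ Z ∧ Q.evalEval (w.2 : ℂ) (w.1 : ℂ) = 0 ∧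
      (derivative Q).evalEval (w.2 : ℂ) (w.1 : ℂ) ≠ 0} with hS
  set Φ : ℝ × ℝ → ℂ := fun w => Q.evalEval (w.2 : ℂ) (w.1 : ℂ) with hΦ
  have hloc : ∀ w₀ ∈ S, ∃ N ∈ nhds w₀, volume (Prod.fst '' (S ∩ N)) = 0 := by
    intro w₀ hw₀
    have hst : HasStrictFDerivAt Φ (fderiv ℝ Φ w₀) w₀ :=
      (contDiff_evalEval Q).contDiffAt.hasStrictFDerivAt (by simp)
    set L := fderiv ℝ Φ w₀ with hL
    set a := (derivative Q).evalEval (w₀.2 : ℂ) (w₀.1 : ℂ) with ha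
    have ha0 : a ≠ 0 := hw₀.2.2
    have hLa : L (1, 0) = a := by
      have h1 : HasDerivAt (fun t : ℝ => ((t, w₀.2) : ℝ × ℝ)) (1, 0) w₀.1 :=
        (hasDerivAt_id w₀.1).prodMk (hasDerivAt_const w₀.1 w₀.2)
      have h2 : HasFDerivAt Φ L ((fun t : ℝ => ((t, w₀.2) : ℝ × ℝ)) w₀.1) := hst.hasFDerivAt
      have h3 : HasDerivAt (fun t : ℝ => Φ (t, w₀.2)) (L (1, 0)) w₀.1 :=
        HasFDerivAt.comp_hasDerivAt (l := Φ) (l' := L) (f := fun t : ℝ => (t, w₀.2)) w₀.1 h2 h1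
      exact h3.unique (hasDerivAt_evalEval Q w₀.2 w₀.1)
    set b := L (0, 1) with hb
    have hLw (u v : ℝ) : L (u, v) = u • a + v • b := by
      rw [← hLa, hb, ← map_smul, ← map_smul, ← map_add]
      simp
    have hsm := hst.isLittleO.def (show 0 < ‖a‖ / 2 by positivity)
    rw [nhds_prod_eq, Filter.eventually_iff, Filter.mem_prod_same_iff] at hsm
    obtain ⟨N, hN, hNs⟩ := hsm
    refine ⟨N, hN, volume_fst_image_eq_zero_of_dist_le
      -- Solves `‖a‖ |Δt| ≤ ‖b‖ |Δx| + (‖a‖ / 2) (|Δt| + |Δx|)` for `|Δt|`.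
      (K := ⟨2 * ‖b‖ / ‖a‖ + 1, by positivity⟩) ?_ ?_⟩
    · intro w hw w' hw'
      have h : ‖Φ w - Φ w' - L (w - w')‖ ≤ ‖a‖ / 2 * ‖w - w'‖ :=
        hNs (Set.mk_mem_prod hw.2 hw'.2)
      have e1 : Φ w = 0 := hw.1.2.1
      have e2 : Φ w' = 0 := hw'.1.2.1
      rw [e1, e2, sub_self, zero_sub, norm_neg,
        show w - w' = (w.1 - w'.1, w.2 - w'.2) from rfl, hLw] at h
      have h3 : ‖(w.1 - w'.1) • a‖ ≤
          ‖(w.1 - w'.1) • a + (w.2 - w'.2) • b‖ + ‖(w.2 - w'.2) • b‖ := by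
        simpa using norm_sub_le ((w.1 - w'.1) • a + (w.2 - w'.2) • b) ((w.2 - w'.2) • b)
      have h4 : ‖((w.1 - w'.1, w.2 - w'.2) : ℝ × ℝ)‖ ≤ dist w.1 w'.1 + dist w.2 w'.2 := by
        rw [Prod.norm_def, Real.dist_eq, Real.dist_eq]
        exact max_le (le_add_of_nonneg_right (abs_nonneg _)) (le_add_of_nonneg_left (abs_nonneg _))
      rw [norm_smul, norm_smul, Real.norm_eq_abs, Real.norm_eq_abs, ← Real.dist_eq,
        ← Real.dist_eq] at h3
      have hpos : 0 < ‖a‖ := norm_pos_iff.2 ha0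
      have h5 := mul_le_mul_of_nonneg_left h4 (show 0 ≤ ‖a‖ / 2 by positivity)
      change _ ≤ (2 * ‖b‖ / ‖a‖ + 1) * _
      have h6 : ‖a‖ * dist w.1 w'.1 ≤ (2 * ‖b‖ + ‖a‖) * dist w.2 w'.2 := by nlinarith
      have h7 : (2 * ‖b‖ / ‖a‖ + 1) * dist w.2 w'.2 =
          (2 * ‖b‖ + ‖a‖) * dist w.2 w'.2 / ‖a‖ := by field_simp
      rw [h7, le_div_iff₀ hpos]
      linarith
    · refine measure_mono_null ?_ hZ
      rintro _ ⟨w, hw, rfl⟩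
      exact hw.1.1
  choose! N hN hN0 using hloc
  obtain ⟨T, hTS, hTc, hST⟩ := TopologicalSpace.countable_cover_nhdsWithin
    (s := S) (f := N) fun w hw => mem_nhdsWithin_of_mem_nhds (hN w hw)
  refine measure_mono_null (t := ⋃ w ∈ T, Prod.fst '' (S ∩ N w)) ?_
    ((measure_biUnion_null_iff hTc).2 fun w hw => hN0 w (hTS hw))
  rintro _ ⟨w, hw, rfl⟩
  obtain ⟨w', hw', hww'⟩ := Set.mem_iUnion₂.1 (hST hw)
  exact Set.mem_iUnion₂.2 ⟨w', hw', w, ⟨hw, hww'⟩, rfl⟩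

/-- Let `P` be a polynomial in `t` whose coefficients are polynomials in `x`. For almost every `t`,
the roots `x` of `P(·, t)` in a null set are those `x` for which `P(x, ·)` vanishes identically. -/
theorem ae_forall_evalEval_eq_zero (P : ℂ[X][X]) {Z : Set ℝ} (hZ : volume Z = 0) :
    ∀ᵐ t : ℝ, ∀ x ∈ Z, P.evalEval (x : ℂ) (t : ℂ) = 0 → P.map (evalRingHom (x : ℂ)) = 0 := by
  have h : ∀ᵐ t : ℝ, ∀ k : ℕ, t ∉ Prod.fst '' {w : ℝ × ℝ | w.2 ∈ Z ∧
      (derivative^[k] P).evalEval (w.2 : ℂ) (w.1 : ℂ) = 0 ∧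
      (derivative (derivative^[k] P)).evalEval (w.2 : ℂ) (w.1 : ℂ) ≠ 0} :=
    ae_all_iff.2 fun k =>
      compl_mem_ae_iff.2 (volume_fst_image_simple_zeros (derivative^[k] P) hZ)
  filter_upwards [h] with t ht x hx hroot
  by_contra hne
  -- A first non-vanishing `t`-derivative would make the preceding one have a simple zero over `Z`,
  -- and such `t` were discarded. So `P(x, ·)` vanishes at `t` to infinite order.
  have hall (k : ℕ) : (derivative^[k] P).evalEval (x : ℂ) (t : ℂ) = 0 := by
    induction k with
    | zero => exact hroot
    | succ k ih =>
      by_contra hk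
      rw [Function.iterate_succ_apply'] at hk
      exact ht k ⟨(t, x), ⟨hx, ih, hk⟩, rfl⟩
  have hlt := (lt_rootMultiplicity_iff_isRoot_iterate_derivative
    (n := (P.map (evalRingHom (x : ℂ))).rootMultiplicity (t : ℂ)) hne).2 fun k _ => by
      rw [IsRoot, iterate_derivative_map, ← evalEval_eq_eval_map]
      exact hall k
  exact lt_irrefl _ hlt

/-! ### Eigenvalues of the pencil -/

section Eigenvalues

variable {n : ℕ} {A B : Matrix (Fin n) (Fin n) ℂ}

theorem traceFun_eq_sum_eigenvalues {M : Matrix (Fin n) (Fin n) ℂ} (hM : M.IsHermitian)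
    (h : ℝ → ℝ) : traceFun h M = ∑ i, h (hM.eigenvalues i) := by
  rw [traceFun, hM.cfc_eq, Matrix.IsHermitian.cfc, Unitary.conjStarAlgAut_apply,
    Matrix.trace_mul_comm, ← mul_assoc, Unitary.coe_star_mul_self, one_mul, Matrix.trace_diagonal,
    Complex.re_sum]
  rfl

/-- The characteristic polynomial of `A + t B`, with coefficients polynomials in `t`. -/
noncomputable def pencilCharpoly (A B : Matrix (Fin n) (Fin n) ℂ) : ℂ[X][X] :=
  (A.map C + (X : ℂ[X]) • B.map C).charpoly

theorem pencilCharpoly_map_eval (A B : Matrix (Fin n) (Fin n) ℂ) (t : ℝ) :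
    (pencilCharpoly A B).map (evalRingHom (t : ℂ)) = (A + t • B).charpoly := by
  rw [pencilCharpoly, ← Matrix.charpoly_map]
  congr 1
  ext i j
  simpa using mul_comm (B i j) (t : ℂ)

theorem evalEval_pencilCharpoly (A B : Matrix (Fin n) (Fin n) ℂ) (t : ℝ) (x : ℂ) :
    (pencilCharpoly A B).evalEval (t : ℂ) x = (A + t • B).charpoly.eval x := by
  rw [evalEval_eq_eval_map, pencilCharpoly_map_eval]

theorem evalEval_swap (P : ℂ[X][X]) (x y : ℂ) :
    (Bivariate.swap P).evalEval x y = P.evalEval y x := by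
  have h := Bivariate.aevalAeval_swap x y P
  rwa [coe_aevalAeval_eq_evalEval, coe_aevalAeval_eq_evalEval] at h

/-- Divide the characteristic polynomial over `ℂ[t]` by the highest power of `X - x`; the cofactor
at `X = x` is a non-zero polynomial in `t`, with finitely many roots. -/
theorem ae_rootMultiplicity_charpoly_pencil (A B : Matrix (Fin n) (Fin n) ℂ) (x : ℂ) :
    ∃ m : ℕ, ∀ᵐ t : ℝ, (A + t • B).charpoly.rootMultiplicity x = m := by
  have hne : pencilCharpoly A B ≠ 0 := (Matrix.charpoly_monic _).ne_zero
  obtain ⟨R, hR, hRn⟩ := exists_eq_pow_rootMultiplicity_mul_and_not_dvd _ hne (C x)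
  set m := (pencilCharpoly A B).rootMultiplicity (C x)
  have hR0 : R.eval (C x) ≠ 0 := fun h => hRn (dvd_iff_isRoot.2 h)
  have hfin : {t : ℝ | (R.eval (C x)).eval (t : ℂ) = 0}.Finite := by
    refine Set.Finite.preimage Complex.ofReal_injective.injOn
      ((R.eval (C x)).roots.toFinset.finite_toSet) |>.subset fun t ht => ?_
    simpa [hR0] using ht
  refine ⟨m, ?_⟩
  filter_upwards [compl_mem_ae_iff.2 (hfin.measure_zero volume)] with t ht
  have e : (A + t • B).charpoly = (X - C x) ^ m * R.map (evalRingHom (t : ℂ)) := by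
    rw [← pencilCharpoly_map_eval, hR]
    simp
  have hRt : (R.map (evalRingHom (t : ℂ))).eval x ≠ 0 := by
    rw [← evalEval_eq_eval_map]
    exact ht
  have hRt0 : R.map (evalRingHom (t : ℂ)) ≠ 0 := by
    intro h0
    rw [h0] at hRt
    simp at hRt
  rw [e, rootMultiplicity_mul (mul_ne_zero (pow_ne_zero _ (X_sub_C_ne_zero x)) hRt0),
    rootMultiplicity_X_sub_C_pow, rootMultiplicity_eq_zero hRt, add_zero]

theorem card_eigenvalues_eq {M : Matrix (Fin n) (Fin n) ℂ} (hM : M.IsHermitian) (x : ℝ) :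
    (Finset.univ.filter fun i => hM.eigenvalues i = x).card =
      M.charpoly.rootMultiplicity (x : ℂ) := by
  rw [← count_roots, hM.roots_charpoly_eq_eigenvalues, Multiset.count_map, Finset.card_def]
  congr 1
  simp [eq_comm]

/-- If `h` vanishes off a null set, then `tr h(A + t B)` takes the same value for almost all `t`:
only the eigenvalues common to all `A + t B` contribute. -/
theorem exists_ae_traceFun_const (hA : A.IsHermitian) (hB : B.IsHermitian) {Z : Set ℝ}
    (hZ : volume Z = 0) :
    ∃ T : Set ℝ, (∀ᵐ t, t ∈ T) ∧ ∀ h : ℝ → ℝ, (∀ x ∉ Z, h x = 0) → ∀ t ∈ T, ∀ t' ∈ T,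
      traceFun h (A + t • B) = traceFun h (A + t' • B) := by
  classical
  set P := Bivariate.swap (pencilCharpoly A B) with hP
  have hPe (x t : ℝ) : P.evalEval (x : ℂ) (t : ℂ) = (A + t • B).charpoly.eval (x : ℂ) := by
    rw [hP, evalEval_swap, evalEval_pencilCharpoly]
  have hfin : {x : ℝ | P.map (evalRingHom (x : ℂ)) = 0}.Finite := by
    refine Set.Finite.preimage Complex.ofReal_injective.injOn
      (A.charpoly.roots.toFinset.finite_toSet) |>.subset fun x hx => ?_
    have h0 := hPe x 0
    rw [evalEval_eq_eval_map, Set.mem_ofPred.1 hx] at h0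
    have h1 : A.charpoly ≠ 0 := (Matrix.charpoly_monic _).ne_zero
    simpa [h1] using h0.symm
  set Λ := hfin.toFinset with hΛ
  choose m hm using fun x : ℝ => ae_rootMultiplicity_charpoly_pencil A B (x : ℂ)
  -- The set depends on `Z` but not on `h`, so it serves a whole sequence of functions. `Λ` is the
  -- set of eigenvalues common to all `A + tB`.
  refine ⟨{t | (∀ x ∈ Z, P.evalEval (x : ℂ) (t : ℂ) = 0 → P.map (evalRingHom (x : ℂ)) = 0) ∧
    ∀ x ∈ Λ, (A + t • B).charpoly.rootMultiplicity (x : ℂ) = m x},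
    (ae_forall_evalEval_eq_zero P hZ).and ((Finset.eventually_all Λ).2 fun x _ => hm x), ?_⟩
  intro h hh
  have key : ∀ t : ℝ, ((∀ x ∈ Z, P.evalEval (x : ℂ) (t : ℂ) = 0 →
      P.map (evalRingHom (x : ℂ)) = 0) ∧
      ∀ x ∈ Λ, (A + t • B).charpoly.rootMultiplicity (x : ℂ) = m x) →
      traceFun h (A + t • B) = ∑ x ∈ Λ, m x * h x := by
    rintro t ⟨ht1, ht2⟩
    have hM := hA.add_real_smul hB t
    have e : ∀ i, h (hM.eigenvalues i) =
        ∑ x ∈ Λ, if hM.eigenvalues i = x then h x else 0 := by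
      intro i
      rw [Finset.sum_ite_eq]
      split_ifs with hi
      · rfl
      · refine hh _ fun hZi => hi ?_
        rw [hΛ, Set.Finite.mem_toFinset]
        refine ht1 _ hZi ?_
        rw [hPe, hM.charpoly_eq, eval_prod]
        exact Finset.prod_eq_zero (Finset.mem_univ i) (by simp)
    rw [traceFun_eq_sum_eigenvalues hM, Finset.sum_congr rfl fun i _ => e i, Finset.sum_comm]
    refine Finset.sum_congr rfl fun x hx => ?_
    rw [← Finset.sum_filter, Finset.sum_const, card_eigenvalues_eq hM, ht2 x hx, nsmul_eq_mul]
  exact fun t ht t' ht' => (key t ht).trans (key t' ht').symm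

/-! ### The domain of the pencil -/

theorem mem_spectrum_real_iff {M : Matrix (Fin n) (Fin n) ℂ} (hM : M.IsHermitian) (x : ℝ) :
    x ∈ spectrum ℝ M ↔ M.charpoly.eval (x : ℂ) = 0 := by
  rw [hM.spectrum_real_eq_range_eigenvalues, hM.charpoly_eq, eval_prod, Finset.prod_eq_zero_iff]
  simp [sub_eq_zero, eq_comm (a := x)]

theorem isCompact_spectrum_graph (hA : A.IsHermitian) (hB : B.IsHermitian) {K : Set ℝ}
    (hK : IsCompact K) : IsCompact {w : ℝ × ℝ | w.1 ∈ K ∧ w.2 ∈ spectrum ℝ (A + w.1 • B)} := by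
  -- The eigenvalues over `K` are bounded because their squares sum to `tr (A + tB)²`, which is
  -- continuous in `t`.
  obtain ⟨R, hR⟩ := hK.bddAbove_image
    (contDiff_traceFun_eval hA hB (X ^ 2 : ℝ[X])).continuous.continuousOn
  refine (hK.prod (isCompact_Icc (a := -(|R| + 1)) (b := |R| + 1))).of_isClosed_subset ?_ ?_
  · refine (hK.isClosed.preimage continuous_fst).inter ?_
    have e : {w : ℝ × ℝ | w.2 ∈ spectrum ℝ (A + w.1 • B)} =
        {w : ℝ × ℝ | (Bivariate.swap (pencilCharpoly A B)).evalEval (w.2 : ℂ) (w.1 : ℂ) = 0} := by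
      ext w
      simp only [Set.mem_ofPred_eq]
      rw [mem_spectrum_real_iff (hA.add_real_smul hB w.1), evalEval_swap, evalEval_pencilCharpoly]
    change IsClosed {w : ℝ × ℝ | w.2 ∈ spectrum ℝ (A + w.1 • B)}
    rw [e]
    exact isClosed_eq (contDiff_evalEval _).continuous continuous_const
  · rintro ⟨t, x⟩ ⟨ht, hx⟩
    refine ⟨ht, ?_⟩
    have hM := hA.add_real_smul hB t
    rw [hM.spectrum_real_eq_range_eigenvalues] at hx
    obtain ⟨i, hi⟩ := hx
    have h1 := hR ⟨t, ht, rfl⟩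
    simp only [traceFun_eq_sum_eigenvalues hM, eval_pow, eval_X] at h1
    have h2 := (Finset.single_le_sum (f := fun i => hM.eigenvalues i ^ 2)
      (fun i _ => sq_nonneg _) (Finset.mem_univ i)).trans h1
    simp only [hi] at h2
    have h3 : |x| ≤ |R| + 1 :=
      abs_le_of_sq_le_sq (by nlinarith [le_abs_self R, abs_nonneg R]) (by positivity)
    exact abs_le.1 h3

theorem isOpen_realInterval (a b : EReal) : IsOpen (realInterval a b) :=
  (isOpen_Ioo (a := a) (b := b)).preimage continuous_coe_real_ereal

theorem ordConnected_realInterval (a b : EReal) : (realInterval a b).OrdConnected :=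
  ⟨fun _ hx _ hy _ hz => ⟨hx.1.trans_le (EReal.coe_le_coe_iff.2 hz.1),
    (EReal.coe_le_coe_iff.2 hz.2).trans_lt hy.2⟩⟩

theorem isOpen_pencilDomain (hA : A.IsHermitian) (hB : B.IsHermitian) {I : Set ℝ}
    (hI : IsOpen I) : IsOpen (pencilDomain I A B) := by
  rw [isOpen_iff_mem_nhds]
  intro t₀ ht₀
  have hC : IsCompact (Prod.fst '' ({w : ℝ × ℝ | w.1 ∈ Metric.closedBall t₀ 1 ∧
      w.2 ∈ spectrum ℝ (A + w.1 • B)} ∩ Prod.snd ⁻¹' Iᶜ)) :=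
    ((isCompact_spectrum_graph hA hB (isCompact_closedBall t₀ 1)).inter_right
      (hI.isClosed_compl.preimage continuous_snd)).image continuous_fst
  have hmem : t₀ ∉ Prod.fst '' ({w : ℝ × ℝ | w.1 ∈ Metric.closedBall t₀ 1 ∧
      w.2 ∈ spectrum ℝ (A + w.1 • B)} ∩ Prod.snd ⁻¹' Iᶜ) := by
    rintro ⟨w, ⟨⟨_, h1⟩, h2⟩, rfl⟩
    exact h2 (ht₀ h1)
  filter_upwards [hC.isClosed.isOpen_compl.mem_nhds hmem,
    Metric.closedBall_mem_nhds t₀ zero_lt_one] with t ht htb x hx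
  by_contra hxI
  exact ht ⟨(t, x), ⟨⟨htb, hx⟩, hxI⟩, rfl⟩

theorem exists_Icc_of_isCompact_subset_pencilDomain (hA : A.IsHermitian) (hB : B.IsHermitian)
    {I : Set ℝ} (hI : I.OrdConnected) {K : Set ℝ} (hK : IsCompact K)
    (hKI : K ⊆ pencilDomain I A B) :
    ∃ c d : ℝ, Set.Icc c d ⊆ I ∧ ∀ t ∈ K, spectrum ℝ (A + t • B) ⊆ Set.Icc c d := by
  set S := Prod.snd '' {w : ℝ × ℝ | w.1 ∈ K ∧ w.2 ∈ spectrum ℝ (A + w.1 • B)} with hS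
  have hSc : IsCompact S := (isCompact_spectrum_graph hA hB hK).image continuous_snd
  have hSI : S ⊆ I := by
    rintro _ ⟨w, ⟨h1, h2⟩, rfl⟩
    exact hKI h1 h2
  have hmem {t x : ℝ} (ht : t ∈ K) (hx : x ∈ spectrum ℝ (A + t • B)) : x ∈ S :=
    ⟨(t, x), ⟨ht, hx⟩, rfl⟩
  rcases S.eq_empty_or_nonempty with h0 | hne
  · refine ⟨1, 0, by simp, fun t ht x hx => ?_⟩
    have := hmem ht hx
    rw [h0] at this
    exact this.elim
  · exact ⟨sInf S, sSup S, hI.out (hSI (hSc.sInf_mem hne)) (hSI (hSc.sSup_mem hne)),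
      fun t ht x hx => ⟨csInf_le hSc.bddBelow (hmem ht hx), le_csSup hSc.bddAbove (hmem ht hx)⟩⟩

end Eigenvalues

/-! ### Passage to the limit -/

theorem HasCompactSupport.iteratedDeriv_of_real {ψ : ℝ → ℝ} (hψ : HasCompactSupport ψ) (k : ℕ) :
    HasCompactSupport (iteratedDeriv k ψ) :=
  hψ.of_isClosed_subset (isClosed_tsupport _) (tsupport_iteratedDeriv_subset k ψ)

theorem integral_mul_iteratedDeriv {u ψ : ℝ → ℝ} (hu : ContDiff ℝ ∞ u) (hψ : ContDiff ℝ ∞ ψ)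
    (hψc : HasCompactSupport ψ) (k : ℕ) :
    ∫ t, u t * iteratedDeriv k ψ t = (-1) ^ k * ∫ t, iteratedDeriv k u t * ψ t := by
  induction k generalizing u with
  | zero => simp
  | succ k ih =>
    have hu' : ContDiff ℝ ∞ (deriv u) := (contDiff_infty_iff_deriv.1 hu).2
    have hψk : ContDiff ℝ ∞ (iteratedDeriv k ψ) := by
      rw [iteratedDeriv_eq_iterate]
      exact hψ.iterate_deriv k
    have hψk' : ContDiff ℝ ∞ (deriv (iteratedDeriv k ψ)) := (contDiff_infty_iff_deriv.1 hψk).2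
    have hck := hψc.iteratedDeriv_of_real k
    have h := integral_mul_deriv_eq_deriv_mul_of_integrable (u := u) (v := iteratedDeriv k ψ)
      (fun t _ => ((hu.differentiable (by simp)) t).hasDerivAt)
      (fun t _ => ((hψk.differentiable (by simp)) t).hasDerivAt)
      ((hu.continuous.mul hψk'.continuous).integrable_of_hasCompactSupport hck.deriv.mul_left)
      ((hu'.continuous.mul hψk.continuous).integrable_of_hasCompactSupport hck.mul_left)
      ((hu.continuous.mul hψk.continuous).integrable_of_hasCompactSupport hck.mul_left)
    rw [iteratedDeriv_succ, h, ih hu', iteratedDeriv_succ']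
    ring

section Limit

variable {n : ℕ} {A B : Matrix (Fin n) (Fin n) ℂ}

/-- The error `h m - f` splits into a part on `Z`, whose trace agrees at `t` and `t'` and cancels,
and a part off `Z`, which tends to zero at each eigenvalue. -/
theorem tendsto_traceFun_sub (hA : A.IsHermitian) (hB : B.IsHermitian) {f : ℝ → ℝ}
    {h : ℕ → ℝ → ℝ} {S Z T : Set ℝ}
    (hlim : ∀ x ∈ S, x ∉ Z → Filter.Tendsto (fun m => h m x) Filter.atTop (nhds (f x)))
    (hT : ∀ g : ℝ → ℝ, (∀ x ∉ Z, g x = 0) → ∀ t ∈ T, ∀ t' ∈ T,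
      traceFun g (A + t • B) = traceFun g (A + t' • B))
    {t t' : ℝ} (ht : t ∈ T) (ht' : t' ∈ T) (hSt : spectrum ℝ (A + t • B) ⊆ S)
    (hSt' : spectrum ℝ (A + t' • B) ⊆ S) :
    Filter.Tendsto (fun m => traceFun (h m) (A + t • B) - traceFun (h m) (A + t' • B))
      Filter.atTop (nhds (traceFun f (A + t • B) - traceFun f (A + t' • B))) := by
  classical
  have split (m : ℕ) (r : ℝ) : traceFun (h m) (A + r • B) =
      traceFun f (A + r • B) + traceFun (Z.indicator fun x => h m x - f x) (A + r • B) +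
        traceFun (Zᶜ.indicator fun x => h m x - f x) (A + r • B) := by
    simp only [traceFun_eq_sum_eigenvalues (hA.add_real_smul hB r), ← Finset.sum_add_distrib]
    refine Finset.sum_congr rfl fun i _ => ?_
    by_cases hi : (hA.add_real_smul hB r).eigenvalues i ∈ Z <;> simp [hi]
  have small (r : ℝ) (hr : spectrum ℝ (A + r • B) ⊆ S) : Filter.Tendsto
      (fun m => traceFun (Zᶜ.indicator fun x => h m x - f x) (A + r • B))
      Filter.atTop (nhds 0) := by
    have hM := hA.add_real_smul hB r
    simp only [traceFun_eq_sum_eigenvalues hM]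
    rw [← Finset.sum_const_zero (s := (Finset.univ : Finset (Fin n)))]
    refine tendsto_finsetSum _ fun i _ => ?_
    by_cases hi : hM.eigenvalues i ∈ Z
    · simp [hi]
    · simpa [hi] using
        (hlim _ (hr (hM.eigenvalues_mem_spectrum_real i)) hi).sub_const (f (hM.eigenvalues i))
  have e (m : ℕ) : traceFun (h m) (A + t • B) - traceFun (h m) (A + t' • B) =
      traceFun f (A + t • B) - traceFun f (A + t' • B) +
        (traceFun (Zᶜ.indicator fun x => h m x - f x) (A + t • B) -
          traceFun (Zᶜ.indicator fun x => h m x - f x) (A + t' • B)) := by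
    rw [split m t, split m t', hT (Z.indicator fun x => h m x - f x)
      (fun x hx => Set.indicator_of_notMem hx _) t ht t' ht']
    ring
  simp only [e]
  simpa using ((small t hSt).sub (small t' hSt')).const_add
    (traceFun f (A + t • B) - traceFun f (A + t' • B))

theorem abs_traceFun_le {M : Matrix (Fin n) (Fin n) ℂ} (hM : M.IsHermitian) {h : ℝ → ℝ}
    {S : Set ℝ} {C : ℝ} (hC : ∀ x ∈ S, |h x| ≤ C) (hS : spectrum ℝ M ⊆ S) :
    |traceFun h M| ≤ n * C := by
  rw [traceFun_eq_sum_eigenvalues hM]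
  refine (Finset.abs_sum_le_sum_abs _ _).trans ((Finset.sum_le_sum fun i _ =>
    hC _ (hS (hM.eigenvalues_mem_spectrum_real i))).trans_eq ?_)
  simp

/-- On a compact subset of the domain of the pencil, `t ↦ tr f(A + t B)` is, up to additive
constants, the almost everywhere limit of a bounded sequence of functions `t ↦ tr p(A + t B)` with
`p` a polynomial, having non-negative fourth derivatives. -/
theorem exists_polynomial_traceFun_tendsto {f : ℝ → ℝ} {I : Set ℝ} (hI : IsOpen I)
    (hIc : I.OrdConnected) (hf : HasNonnegDistribDeriv 4 f I) (hA : A.IsHermitian)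
    (hB : B.IsHermitian) {K : Set ℝ} (hK : IsCompact K) (hKJ : K ⊆ pencilDomain I A B) :
    ∃ (p : ℕ → ℝ[X]) (e : ℕ → ℝ) (s C : ℝ),
      (∀ m, ∀ t ∈ K,
        0 ≤ iteratedDeriv 4 (fun t : ℝ => traceFun (fun x => (p m).eval x) (A + t • B)) t) ∧
      (∀ m, ∀ t ∈ K, |traceFun (fun x => (p m).eval x) (A + t • B) - e m| ≤ C) ∧
      ∀ᵐ t, t ∈ K → Filter.Tendsto
        (fun m => traceFun (fun x => (p m).eval x) (A + t • B) - e m)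
        Filter.atTop (nhds (traceFun f (A + t • B) - s)) := by
  obtain ⟨c, d, hcd, hspec⟩ := exists_Icc_of_isCompact_subset_pencilDomain hA hB hIc hK hKJ
  obtain ⟨p, M, hp4, hpM, hlim⟩ := hf.exists_polynomial_tendsto hI hcd
  have hp4' : ∀ m, ∀ t ∈ K,
      0 ≤ iteratedDeriv 4 (fun t : ℝ => traceFun (fun x => (p m).eval x) (A + t • B)) t :=
    fun m t ht => iteratedDeriv_four_traceFun_eval_nonneg hA hB (hp4 m) (hspec t ht)
  have hbd : ∀ m, ∀ t ∈ K, |traceFun (fun x => (p m).eval x) (A + t • B)| ≤ n * M :=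
    fun m t ht => abs_traceFun_le (hA.add_real_smul hB t) (hpM m) (hspec t ht)
  obtain ⟨T, hTae, hT⟩ := exists_ae_traceFun_const hA hB (ae_iff.1 hlim)
  by_cases hex : ∃ t₁ ∈ K, t₁ ∈ T
  · obtain ⟨t₁, h₁K, h₁T⟩ := hex
    refine ⟨p, fun m => traceFun (fun x => (p m).eval x) (A + t₁ • B),
      traceFun f (A + t₁ • B), n * M + n * M, hp4', fun m t ht => ?_, ?_⟩
    · exact (abs_sub _ _).trans (add_le_add (hbd m t ht) (hbd m t₁ h₁K))
    · filter_upwards [hTae] with t htT htK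
      refine tendsto_traceFun_sub hA hB (S := Set.Icc c d) (fun x hx hxZ => ?_) hT htT h₁T
        (hspec t htK) (hspec t₁ h₁K)
      by_contra hnot
      exact hxZ fun h => hnot (h hx)
  -- If `K` misses the full-measure set `T`, there is no reference point, but the convergence claim
  -- is vacuous almost everywhere.
  · refine ⟨p, fun _ => 0, 0, n * M, hp4', fun m t ht => by simpa using hbd m t ht, ?_⟩
    filter_upwards [hTae] with t htT htK
    exact (hex ⟨t, htK, htT⟩).elim

theorem HasNonnegDistribDeriv.traceFun_pencil {f : ℝ → ℝ} {I : Set ℝ} (hI : IsOpen I)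
    (hIc : I.OrdConnected) (hf : HasNonnegDistribDeriv 4 f I) (hA : A.IsHermitian)
    (hB : B.IsHermitian) :
    HasNonnegDistribDeriv 4 (fun t : ℝ => traceFun f (A + t • B)) (pencilDomain I A B) := by
  have hJ := isOpen_pencilDomain hA hB hI
  have hcont (p : ℝ[X]) := (contDiff_traceFun_eval hA hB p).continuous
  have hloc : ∀ K ⊆ pencilDomain I A B, IsCompact K →
      IntegrableOn (fun t : ℝ => traceFun f (A + t • B)) K := by
    intro K hKJ hK
    obtain ⟨p, e, s, C, -, hbd, hlim⟩ :=
      exists_polynomial_traceFun_tendsto hI hIc hf hA hB hK hKJ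
    have hlim' := (ae_restrict_iff' hK.measurableSet).2 hlim
    have hfin : IsFiniteMeasure (volume.restrict K) := ⟨by simpa using hK.measure_lt_top⟩
    have hm : AEStronglyMeasurable (fun t : ℝ => traceFun f (A + t • B) - s)
        (volume.restrict K) :=
      aestronglyMeasurable_of_tendsto_ae Filter.atTop
        (fun m => ((hcont (p m)).sub continuous_const).aestronglyMeasurable) hlim'
    have hi : Integrable (fun t : ℝ => traceFun f (A + t • B) - s) (volume.restrict K) := by
      refine Integrable.of_bound hm C ?_
      filter_upwards [hlim', ae_restrict_mem hK.measurableSet] with t ht htK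
      exact le_of_tendsto ht.norm (Filter.Eventually.of_forall fun m => hbd m t htK)
    exact (hi.add (integrable_const s)).congr (Filter.Eventually.of_forall fun t => by simp)
  refine ⟨(locallyIntegrableOn_iff hJ.isLocallyClosed).2 hloc, ?_⟩
  intro ψ hψ hψc hψJ hψ0
  set K := tsupport ψ with hKdef
  have hK : IsCompact K := hψc
  obtain ⟨p, e, s, C, hp4, hbd, hlim⟩ :=
    exists_polynomial_traceFun_tendsto hI hIc hf hA hB hK hψJ
  have hlim' := (ae_restrict_iff' hK.measurableSet).2 hlim
  have hψ4 : Continuous (iteratedDeriv 4 ψ) := by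
    rw [iteratedDeriv_eq_iterate]
    exact (hψ.iterate_deriv 4).continuous
  have hψi : Integrable (iteratedDeriv 4 ψ) :=
    hψ4.integrable_of_hasCompactSupport (hψc.iteratedDeriv_of_real 4)
  have hoff : ∀ t ∉ K, iteratedDeriv 4 ψ t = 0 := fun t ht => by
    by_contra hne
    exact ht (tsupport_iteratedDeriv_subset 4 ψ (subset_tsupport _ hne))
  -- This makes the additive constants `e m` and `s` harmless.
  have hzero : ∫ t, iteratedDeriv 4 ψ t = 0 := by
    have := integral_mul_iteratedDeriv (u := fun _ => (1 : ℝ)) contDiff_const hψ hψc 4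
    simpa [iteratedDeriv_const] using this
  have hKall (g : ℝ → ℝ) :
      ∫ t in K, g t * iteratedDeriv 4 ψ t = ∫ t, g t * iteratedDeriv 4 ψ t :=
    setIntegral_eq_integral_of_forall_compl_eq_zero fun t ht => by rw [hoff t ht, mul_zero]
  have hD : Filter.Tendsto
      (fun m => ∫ t in K, (traceFun (fun x => (p m).eval x) (A + t • B) - e m) *
        iteratedDeriv 4 ψ t) Filter.atTop
      (nhds (∫ t in K, (traceFun f (A + t • B) - s) * iteratedDeriv 4 ψ t)) := by
    refine tendsto_integral_of_dominated_convergence (fun t => C * |iteratedDeriv 4 ψ t|)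
      (fun m => (((hcont (p m)).sub continuous_const).mul hψ4).aestronglyMeasurable)
      (hψi.abs.const_mul C).integrableOn (fun m => ?_) ?_
    · filter_upwards [ae_restrict_mem hK.measurableSet] with t htK
      rw [norm_mul]
      exact mul_le_mul_of_nonneg_right (hbd m t htK) (norm_nonneg _)
    · filter_upwards [hlim'] with t ht
      exact ht.mul_const _
  have hnn : 0 ≤ ∫ t in K, (traceFun f (A + t • B) - s) * iteratedDeriv 4 ψ t := by
    refine ge_of_tendsto' hD fun m => ?_
    have hu := contDiff_traceFun_eval hA hB (p m)
    rw [hKall]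
    have e1 : ∫ t, (traceFun (fun x => (p m).eval x) (A + t • B) - e m) * iteratedDeriv 4 ψ t =
        ∫ t, traceFun (fun x => (p m).eval x) (A + t • B) * iteratedDeriv 4 ψ t := by
      simp only [sub_mul]
      rw [integral_sub, integral_const_mul, hzero, mul_zero, sub_zero]
      · exact (hu.continuous.mul hψ4).integrable_of_hasCompactSupport
          (hψc.iteratedDeriv_of_real 4).mul_left
      · exact hψi.const_mul _
    rw [e1, integral_mul_iteratedDeriv hu hψ hψc 4]
    refine mul_nonneg (by norm_num) (integral_nonneg fun t => ?_)
    by_cases ht : t ∈ K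
    · exact mul_nonneg (hp4 m t ht) (hψ0 t)
    · simp [image_eq_zero_of_notMem_tsupport ht]
  have hint : IntegrableOn (fun t : ℝ => (traceFun f (A + t • B) - s) * iteratedDeriv 4 ψ t) K :=
    (((hloc K hψJ hK).sub (integrableOn_const hK.measure_lt_top.ne)).mul_continuousOn
      hψ4.continuousOn hK)
  have hfinal : ∫ t in pencilDomain I A B, traceFun f (A + t • B) * iteratedDeriv 4 ψ t =
      ∫ t in K, (traceFun f (A + t • B) - s) * iteratedDeriv 4 ψ t := by
    rw [setIntegral_eq_of_subset_of_forall_sdiff_eq_zero hJ.measurableSet hψJ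
      fun t ht => by rw [hoff t ht.2, mul_zero]]
    have e2 : ∀ t, traceFun f (A + t • B) * iteratedDeriv 4 ψ t =
        (traceFun f (A + t • B) - s) * iteratedDeriv 4 ψ t + s * iteratedDeriv 4 ψ t :=
      fun t => by ring
    simp only [e2]
    rw [integral_add hint (hψi.const_mul s).integrableOn, hKall fun _ => s, integral_const_mul,
      hzero, mul_zero, add_zero]
  rw [hfinal]
  exact mul_nonneg (by norm_num) hnn

end Limit

theorem theorem3 (a b : EReal) (f : ℝ → ℝ)
    (hf : HasNonnegDistribDeriv 4 f (realInterval a b))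
    (n : ℕ) (A B : Matrix (Fin n) (Fin n) ℂ) (hA : A.IsHermitian) (hB : B.IsHermitian) :
    HasNonnegDistribDeriv 4 (fun t : ℝ => traceFun f (A + t • B))
      (pencilDomain (realInterval a b) A B) :=
  hf.traceFun_pencil (isOpen_realInterval a b) (ordConnected_realInterval a b) hA hB
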